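/- Consider a chain of $n$ particles with Hilbert space $(\mathbb C^d)^{\otimes n}$, sites counted modulo $n$. For complex $D\times D$ matrices $\omega,A_1,\dots,A_d$, the (unnormalised) matrix product state (MPS) of bond dimension $D$ is $$|\psi(\omega,A,n)\rangle=\sum_{i_1,\dots,i_n=1}^d \operatorname{tr}(\omega A_{i_1}\cdots A_{i_n})\,|i_1,\dots,i_n\rangle ;$$ it is called a finite translation-invariant (TI) MPS if $\omega=\mathbb I_D$. A $k$-local Hamiltonian ($k\le n$) is an operator $H=\sum_{j=1}^n h_j$ with $h_j$ self-adjoint and acting nontrivially only on the particles $j,j+1,\dots,j+k-1$ (modulo $n$); it is TI if it commutes with the cyclic translation $1\to2\to\cdots\to n\to1$. Let $\langle H\rangle_D$ be the infimum of $\langle\psi|H|\psi\rangle/\langle\psi|\psi\rangle$ over all nonzero MPS $\psi$ of bond dimension $D$, and let $\langle H\rangle^{\mathrm{TI}}_D$ be the infimum over the nonzero ones with $\omega=\mathbb I_D$. An infinite MPS (iMPS) of bond dimension $D$ is given by $D\times D$ matrices $A_1,\dots,A_d,\sigma$ with $\sum_i A_iA_i^\dagger=\mathbb I_D$, $\sigma\ge0$,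 $\operatorname{tr}\sigma=1$, $\sum_iA_i^\dagger\sigma A_i=\sigma$; its $m$-site reduced density matrix is $\rho_m=\sum_{\vec i,\vec j}\operatorname{tr}(A_{j_m}^\dagger\cdots A_{j_1}^\dagger\sigma A_{i_1}\cdots A_{i_m})|\vec i\rangle\langle\vec j|$. A $k$-local TI Hamiltonian on the infinite chain is given by a self-adjoint operator $h$ on $k$ neighbouring particles, of which it is the formal sum of all translates; let $\langle h\rangle^{\infty}_D$ be the infimum of the energy per site $\operatorname{tr}(\rho_k h)$ over all iMPS of bond dimension $D$. **Proposition.** There is a constant $C$ such that for all natural numbers $D>D'>1$ the following hold with $d=2$. 1. For every $N$ there are $n>N$, $k\le C D^2$ and a $k$-local TI Hamiltonian $H$ on $n$ qubits such that $$\langle H\rangle_{D'-1}>\langle H\rangle_{D'}=\langle H\rangle_{D'+1}=\cdots=\langle H\rangle_{D}>\langle H\rangle_{D+1},$$ and such that the same chain of relations holds for $\langle H\rangle^{\mathrm{TI}}$ in place of $\langle H\rangle$. 2. There are $k\le C D^2$ and a $k$-local TI Hamiltonian on the infinite chain of qubits, given by $h$, such that the same chain of relations holds for $\langle h\rangle^\infty$.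 Moreover, there is a constant $C$ such that for all $D>D'>1$ statements 1 and 2 hold for particles of physical dimension $d=2D$ in place of qubits, with $k\le C D$ in place of $k\le CD^2$. -/

import Mathlib

/-! Spin chains of `n` particles of physical dimension `d`. The product basis of `(ℂ^d)^{⊗n}` is
indexed by `Fin n → Fin d`; vectors are functions on this basis and operators are matrices. -/

namespace MPSChain

section

open scoped ComplexOrder

/-- The matrix product `A_{i₁} A_{i₂} ⋯ A_{iₙ}`. -/
noncomputable def word {D d n : ℕ} (A : Fin d → Matrix (Fin D) (Fin D) ℂ) (i : Fin n → Fin d) :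
    Matrix (Fin D) (Fin D) ℂ :=
  (List.ofFn fun j => A (i j)).prod

/-- The (unnormalised) matrix product state `∑ tr(ω A_{i₁} ⋯ A_{iₙ}) |i₁, …, iₙ⟩`. -/
noncomputable def mps {D d : ℕ} (n : ℕ) (ω : Matrix (Fin D) (Fin D) ℂ)
    (A : Fin d → Matrix (Fin D) (Fin D) ℂ) : (Fin n → Fin d) → ℂ :=
  fun i => (ω * word A i).trace

/-- The average value `⟨ψ|H|ψ⟩ / ⟨ψ|ψ⟩` (used for `ψ ≠ 0`). -/
noncomputable def average {d n : ℕ} (H : Matrix (Fin n → Fin d) (Fin n → Fin d) ℂ)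
    (ψ : (Fin n → Fin d) → ℂ) : ℝ :=
  (star ψ ⬝ᵥ H.mulVec ψ).re / (star ψ ⬝ᵥ ψ).re

/-- The average values of `H` achievable with matrix product states of bond dimension `D`,
with arbitrary boundary condition `ω`. -/
def mpsEnergies {d n : ℕ} (H : Matrix (Fin n → Fin d) (Fin n → Fin d) ℂ) (D : ℕ) : Set ℝ :=
  {E | ∃ (ω : Matrix (Fin D) (Fin D) ℂ) (A : Fin d → Matrix (Fin D) (Fin D) ℂ),
    mps n ω A ≠ 0 ∧ E = average H (mps n ω A)}

/-- The average values of `H` achievable with finite translation-invariant matrix product states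
of bond dimension `D`, i.e. with `ω = 1`. -/
def tiMpsEnergies {d n : ℕ} (H : Matrix (Fin n → Fin d) (Fin n → Fin d) ℂ) (D : ℕ) : Set ℝ :=
  {E | ∃ A : Fin d → Matrix (Fin D) (Fin D) ℂ,
    mps n 1 A ≠ 0 ∧ E = average H (mps n 1 A)}

/-- The sites `j, j + 1, …, j + k - 1`, counted modulo `n`. -/
def window {n : ℕ} (k : ℕ) (j : Fin n) : Set (Fin n) :=
  {i | ∃ l < k, (i : ℕ) = ((j : ℕ) + l) % n}

/-- `M` acts nontrivially only on the sites in `S`, i.e. `M = M₀ ⊗ 1` for some operator `M₀` on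
the particles in `S`. -/
def ActsOn {d n : ℕ} (S : Set (Fin n)) (M : Matrix (Fin n → Fin d) (Fin n → Fin d) ℂ) : Prop :=
  ∃ M₀ : Matrix (S → Fin d) (S → Fin d) ℂ,
    (∀ x y, (∀ i, i ∉ S → x i = y i) → M x y = M₀ (fun i => x i) (fun i => y i)) ∧
    (∀ x y, (∃ i, i ∉ S ∧ x i ≠ y i) → M x y = 0)

/-- `H` is a `k`-local Hamiltonian: `H = ∑_{j=1}^n h_j`, with `h_j` self-adjoint and acting
nontrivially only on the particles `j, …, j + k - 1` (modulo `n`), where `k ≤ n`. -/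
def IsLocalHamiltonian {d n : ℕ} (k : ℕ) (H : Matrix (Fin n → Fin d) (Fin n → Fin d) ℂ) : Prop :=
  k ≤ n ∧ ∃ h : Fin n → Matrix (Fin n → Fin d) (Fin n → Fin d) ℂ,
    (∀ j, (h j).IsHermitian ∧ ActsOn (window k j) (h j)) ∧ H = ∑ j, h j

/-- `H` is invariant under the cyclic translation `1 → 2 → ⋯ → n → 1` of the particles. -/
def IsTranslationInvariant {d n : ℕ} (H : Matrix (Fin n → Fin d) (Fin n → Fin d) ℂ) : Prop :=
  ∀ x y : Fin n → Fin d, H (x ∘ finRotate n) (y ∘ finRotate n) = H x y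

/-- `(A, σ)` defines an infinite matrix product state (iMPS) of bond dimension `D`:
`∑ A_i A_i† = 1`, `σ ≥ 0`, `tr σ = 1` and `∑ A_i† σ A_i = σ`. -/
structure IsIMPS {D d : ℕ} (A : Fin d → Matrix (Fin D) (Fin D) ℂ)
    (σ : Matrix (Fin D) (Fin D) ℂ) : Prop where
  isometric : ∑ i, A i * (A i).conjTranspose = 1
  posSemidef : σ.PosSemidef
  trace_eq_one : σ.trace = 1
  stationary : ∑ i, (A i).conjTranspose * σ * A i = σ

/-- The `m`-site reduced density matrix of the iMPS given by `(A, σ)`, with entries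
`⟨i|ρ|j⟩ = tr(A_{j_m}† ⋯ A_{j₁}† σ A_{i₁} ⋯ A_{i_m})`. -/
noncomputable def reducedDensity {D d : ℕ} (m : ℕ) (A : Fin d → Matrix (Fin D) (Fin D) ℂ)
    (σ : Matrix (Fin D) (Fin D) ℂ) : Matrix (Fin m → Fin d) (Fin m → Fin d) ℂ :=
  Matrix.of fun i j => ((word A j).conjTranspose * σ * word A i).trace

/-- The energies per site `tr(ρ_k h)` achievable with iMPS of bond dimension `D`, for the
translation-invariant Hamiltonian on the infinite chain that is the formal sum of all the
translates of the `k`-particle operator `h`. -/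
def impsEnergies {d k : ℕ} (h : Matrix (Fin k → Fin d) (Fin k → Fin d) ℂ) (D : ℕ) : Set ℝ :=
  {E | ∃ (A : Fin d → Matrix (Fin D) (Fin D) ℂ) (σ : Matrix (Fin D) (Fin D) ℂ),
    IsIMPS A σ ∧ E = (reducedDensity k A σ * h).trace.re}

/-- If `S b` is the set of energies achievable with bond dimension `b` and `e b` is its infimum,
then `e (D' - 1) > e D' = e (D' + 1) = ⋯ = e D > e (D + 1)`. The infima are required to exist. -/
def EnergyChain (S : ℕ → Set ℝ) (D' D : ℕ) : Prop :=
  ∃ e : ℕ → ℝ, (∀ b, 1 ≤ b → (S b).Nonempty ∧ IsGLB (S b) (e b)) ∧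
    e (D' - 1) > e D' ∧ (∀ b, D' ≤ b → b ≤ D → e b = e D') ∧ e D > e (D + 1)

end

end MPSChain

/-! The proof rests on the Amitsur–Levitzki theorem and its sharpness. The standard polynomial of
degree `2 b` vanishes on matrices of size `b`, but not on the staircase `E₀₀ E₀₁ E₁₁ E₁₂ ⋯` of
matrix units of size `b + 1`, since only one ordering of that product is nonzero. Evaluated on fixed
words in the `A_i`, it gives linear equations that the restriction of an MPS to a window satisfies
at bond dimension `b` and can violate at `b + 1`.

The local term is `h₀ - ε |g⟩⟨g|`. Here `h₀ ≥ 0` has as its kernel exactly the window vectors of one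
explicit family `A` of size `D'`, so `A` reaches energy zero. Window vectors of bond dimension `D' -
1` satisfy the standard identities of degree `2 (D' - 1)` at all positions, and no nonzero window
vector of `A` does (`IsRigidFamily.eq_zero`). Compactness turns this trivial intersection into a
uniform gap (`exists_pos_mul_nsq_le_form`).

The vector `g` contains the standard polynomial of degree `2 D` twice. It is orthogonal to every
window vector of bond dimension at most `D`, even if the boundary matrix `ω` falls inside the
window, because `ω` disturbs only one of the two copies (`star_doubleStandard_dotProduct_isCut`).
Hence the term with `ε` is invisible up to `D`: energies are nonnegative there, and zero is attained
from `D'` on by padding `A`. At `D + 1` an explicit family `B` overlaps with `g`, and a large `ε`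
makes its energy negative.

Both settings reduce to window vectors: a finite chain through `card_mul_form_localOp`, an iMPS
through `trace_reducedDensity_mul`. The families are transition matrices of automata on a cycle. For
qubits only one vertex is marked, so a word determines its starting vertex after a full turn; about
`2 D` words of length about `D` give locality of order `D ^ 2`. With `2 D` letters words of length
at most two suffice, which gives order `D`. -/

namespace MPSChain

/-! ### Nilpotency of matrices whose powers have trace zero. -/

open Polynomial in
/-- Jacobi's formula for the derivative of the characteristic polynomial. -/
theorem derivative_charpoly {R ι : Type*} [CommRing R] [Fintype ι] [DecidableEq ι]
    (M : Matrix ι ι R) : derivative M.charpoly = M.charmatrix.adjugate.trace := by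
  classical
  have hd : ∀ i j, derivative (M.charmatrix i j) = if i = j then 1 else 0 := by
    intro i j
    rw [Matrix.charmatrix_apply]
    by_cases h : i = j <;> simp [h]
  rw [Matrix.charpoly, Matrix.trace]
  simp only [Matrix.diag_apply, Matrix.adjugate_apply, Matrix.det_apply]
  rw [derivative_sum, Finset.sum_comm]
  refine Finset.sum_congr rfl fun σ _ => ?_
  rw [← Finset.smul_sum, derivative_smul, derivative_prod_finset]
  congr 1
  -- The row `x` replaced in the adjugate is matched with the column `i` of the differentiated
  -- factor by `x = σ i`.
  rw [← Equiv.sum_comp σ fun x => ∏ i, M.charmatrix.updateRow x (Pi.single x 1) (σ i) i]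
  refine Finset.sum_congr rfl fun i _ => ?_
  rw [← Finset.mul_prod_erase Finset.univ _ (Finset.mem_univ i), hd, mul_comm]
  congr 1
  · by_cases h : σ i = i
    · simp [h]
    · rw [if_neg h, Matrix.updateRow_self, Pi.single_apply, if_neg (fun e => h e.symm)]
  · refine Finset.prod_congr rfl fun j hj => ?_
    rw [Matrix.updateRow_ne]
    exact fun e => (Finset.ne_of_mem_erase hj) (σ.injective e)

open Polynomial in
/-- The adjugate of the characteristic matrix in terms of the coefficients of the characteristic
polynomial. -/
theorem adjugate_charmatrix {R ι : Type*} [CommRing R] [Fintype ι] [DecidableEq ι]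
    (M : Matrix ι ι R) : M.charmatrix.adjugate =
      ∑ j ∈ Finset.range (M.charpoly.natDegree + 1), C (M.charpoly.coeff j) •
        ∑ i ∈ Finset.range j, (X : R[X]) ^ i • (M ^ (j - 1 - i)).map C := by
  set Q := ∑ j ∈ Finset.range (M.charpoly.natDegree + 1), C (M.charpoly.coeff j) •
        ∑ i ∈ Finset.range j, (X : R[X]) ^ i • (M ^ (j - 1 - i)).map C with hQ
  have hN : M.charmatrix = Matrix.scalar ι (X : R[X]) - M.map C := rfl
  have hpow : ∀ m : ℕ, (M ^ m).map (C : R →+* R[X]) = (M.map C) ^ m := fun m =>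
    map_pow (C : R →+* R[X]).mapMatrix M m
  have hcomm : Commute (Matrix.scalar ι (X : R[X])) (M.map C) :=
    Matrix.scalar_commute _ (fun r => Commute.all _ _) _
  have h1 : M.charmatrix * Q = M.charmatrix * M.charmatrix.adjugate := by
    rw [Matrix.mul_adjugate, hQ, Finset.mul_sum]
    -- The geometric sum gives `(X - M) ∑ Xⁱ M^(j-1-i) = X^j - M^j`. Weighted by the coefficients of
    -- the characteristic polynomial `p`, the right sides add up to `p(X) - p(M) = p(X)` by
    -- Cayley–Hamilton.
    have h2 : ∀ j, M.charmatrix * (C (M.charpoly.coeff j) •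
        ∑ i ∈ Finset.range j, (X : R[X]) ^ i • (M ^ (j - 1 - i)).map C) =
        (C (M.charpoly.coeff j) * X ^ j) • (1 : Matrix ι ι R[X]) -
          (M.charpoly.coeff j • M ^ j).map C := by
      intro j
      have h3 : ∀ i, (X : R[X]) ^ i • (M ^ (j - 1 - i)).map (C : R →+* R[X]) =
          Matrix.scalar ι (X : R[X]) ^ i * (M.map C) ^ (j - 1 - i) := by
        intro i
        rw [hpow, ← map_pow, Matrix.scalar_apply, Matrix.smul_eq_diagonal_mul]
      rw [Matrix.mul_smul, hN]
      simp only [h3]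
      rw [hcomm.mul_geom_sum₂, ← map_pow, smul_sub, ← hpow]
      congr 1
      · ext a b
        simp [Matrix.one_apply, Matrix.diagonal_apply]
      · ext a b
        simp
    simp only [h2]
    rw [Finset.sum_sub_distrib, ← Finset.sum_smul, ← Polynomial.as_sum_range_C_mul_X_pow]
    have h4 : ∑ j ∈ Finset.range (M.charpoly.natDegree + 1),
        (M.charpoly.coeff j • M ^ j).map (C : R →+* R[X]) = 0 := by
      have := Matrix.aeval_self_charpoly M
      rw [Polynomial.aeval_eq_sum_range] at this
      have h5 := congrArg (C : R →+* R[X]).mapMatrix this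
      rw [map_sum, map_zero] at h5
      exact h5
    rw [h4, sub_zero]
    rfl
  -- The characteristic matrix is cancelled by multiplying with its adjugate, which leaves a monic
  -- scalar factor.
  have h6 : M.charpoly • (Q - M.charmatrix.adjugate) = 0 := by
    have : M.charmatrix.adjugate * (M.charmatrix * (Q - M.charmatrix.adjugate)) = 0 := by
      rw [mul_sub, h1, sub_self, mul_zero]
    rwa [← mul_assoc, Matrix.adjugate_mul, Matrix.smul_mul, one_mul] at this
  have h7 : Q - M.charmatrix.adjugate = 0 := by
    ext1 a b
    have := congrFun (congrFun h6 a) b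
    rw [Matrix.smul_apply, smul_eq_mul] at this
    exact (Matrix.charpoly_monic M).mul_right_eq_zero_iff.1 this
  exact (sub_eq_zero.1 h7).symm

open Polynomial in
/-- A square matrix of size `n` over a commutative `ℚ`-algebra whose first `n` powers have trace
zero satisfies `M ^ n = 0`. -/
theorem pow_card_eq_zero_of_trace_pow {R ι : Type*} [CommRing R] [Algebra ℚ R] [Fintype ι]
    [DecidableEq ι] (M : Matrix ι ι R) (h : ∀ k, 0 < k → (M ^ k).trace = 0) :
    M ^ Fintype.card ι = 0 := by
  nontriviality R
  have hq : ∀ (m : ℕ) (r : R), m ≠ 0 → (m : R) * r = 0 → r = 0 := by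
    intro m r hm hr
    have h1 : algebraMap ℚ R (m : ℚ)⁻¹ * ((m : R) * r) = 0 := by rw [hr, mul_zero]
    rw [← mul_assoc, ← map_natCast (algebraMap ℚ R) m, ← map_mul,
      inv_mul_cancel₀ (by exact_mod_cast hm), map_one, one_mul] at h1
    exact h1
  have hn := Matrix.charpoly_natDegree_eq_dim M
  have hder := derivative_charpoly M
  rw [adjugate_charmatrix, Matrix.trace_sum] at hder
  -- In the coefficient of `X^k` of Jacobi's formula only the trace of `M⁰` survives, so `(k + 1)
  -- c_{k+1} = n c_{k+1}`. All coefficients strictly between the constant and the leading one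
  -- therefore vanish. Cayley–Hamilton then reads `Mⁿ + c₀ = 0`, and its trace gives `c₀ = 0`.
  have hcoef : ∀ k, k + 1 < Fintype.card ι → M.charpoly.coeff (k + 1) = 0 := by
    intro k hk
    have h1 := congrArg (fun p : R[X] => p.coeff k) hder
    simp only [coeff_derivative, finsetSum_coeff, Matrix.trace_smul, Matrix.trace_sum] at h1
    have h2 : ∀ j i, ((M ^ (j - 1 - i)).map (C : R →+* R[X])).trace =
        C ((M ^ (j - 1 - i)).trace) := by
      intro j i
      simp [Matrix.trace]
    simp only [h2, smul_eq_mul, coeff_C_mul, finsetSum_coeff, coeff_X_pow_mul', coeff_C] at h1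
    rw [Finset.sum_eq_single (k + 1)] at h1
    · rw [Finset.sum_eq_single k] at h1
      · simp only [le_refl, if_true, Nat.sub_self, Nat.add_sub_cancel, pow_zero,
          Matrix.trace_one] at h1
        have h3 : ((Fintype.card ι - (k + 1) : ℕ) : R) * M.charpoly.coeff (k + 1) = 0 := by
          rw [Nat.cast_sub hk.le, sub_mul, sub_eq_zero, mul_comm, ← h1]
          push_cast
          ring
        exact hq _ _ (by omega) h3
      · intro i hi hik
        rw [Finset.mem_range] at hi
        split_ifs
        · omega
        · rfl
        · rfl
      · simp
    · intro j hj hjk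
      rw [Finset.sum_eq_zero, mul_zero]
      intro i hi
      rw [Finset.mem_range] at hi
      split_ifs with h4 h5
      · exact h _ (by omega)
      · rfl
      · rfl
    · intro h4
      exact absurd (Finset.mem_range.2 (by omega)) h4
  have hch := Matrix.aeval_self_charpoly M
  rw [Polynomial.aeval_eq_sum_range, hn, Finset.sum_range_succ] at hch
  have hlead : M.charpoly.coeff (Fintype.card ι) = 1 := by
    have := Matrix.charpoly_monic M
    rwa [Monic, leadingCoeff, hn] at this
  rcases Nat.eq_zero_or_pos (Fintype.card ι) with h0 | h0
  · have := Fintype.card_eq_zero_iff.1 h0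
    exact Subsingleton.elim _ _
  rw [Finset.sum_eq_single_of_mem 0 (Finset.mem_range.2 h0)] at hch
  · rw [hlead, one_smul, pow_zero] at hch
    have h5 := congrArg Matrix.trace hch
    rw [Matrix.trace_add, h _ h0, Matrix.trace_smul, Matrix.trace_one, add_zero, smul_eq_mul,
      Matrix.trace_zero, mul_comm] at h5
    rw [hq _ _ h0.ne' h5, zero_smul, zero_add] at hch
    exact hch
  · intro j hj hj0
    rw [Finset.mem_range] at hj
    obtain ⟨j, rfl⟩ := Nat.exists_eq_succ_of_ne_zero hj0
    rw [hcoef j hj, zero_smul]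

/-! ### The Amitsur–Levitzki theorem by Rosset's exterior algebra argument. -/

/-- Sums over words of length `n + 1` split off the first letter. -/
theorem sum_fin_cons {α M : Type*} [Fintype α] [AddCommMonoid M] {n : ℕ}
    (F : (Fin (n + 1) → α) → M) :
    ∑ f, F f = ∑ a, ∑ g : Fin n → α, F (Fin.cons a g) := by
  rw [← Fintype.sum_prod_type', ← (Fin.consEquiv fun _ : Fin (n + 1) => α).sum_comp]
  rfl

/-- Moving a generator past two generators changes the sign twice. -/
theorem mem_center_exteriorAlgebra {V : Type*} [AddCommGroup V] [Module ℂ V] (u v : V) :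
    ExteriorAlgebra.ι ℂ u * ExteriorAlgebra.ι ℂ v ∈
      Subalgebra.center ℂ (ExteriorAlgebra ℂ V) := by
  rw [Subalgebra.mem_center_iff]
  have hanti : ∀ x y : V, ExteriorAlgebra.ι ℂ x * ExteriorAlgebra.ι ℂ y =
      -(ExteriorAlgebra.ι ℂ y * ExteriorAlgebra.ι ℂ x) := fun x y =>
    eq_neg_of_add_eq_zero_left (ExteriorAlgebra.ι_add_mul_swap x y)
  intro b
  induction b using ExteriorAlgebra.induction with
  | algebraMap r => exact Algebra.commutes r _
  | ι x =>
    rw [← mul_assoc, hanti x u, neg_mul, mul_assoc, hanti x v, mul_neg, neg_neg, mul_assoc]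
  | mul a b ha hb => rw [mul_assoc, hb, ← mul_assoc, ha, mul_assoc]
  | add a b ha hb => rw [add_mul, mul_add, ha, hb]

/-- The trace of a positive even power of a matrix with entries in the generating space of an
exterior algebra vanishes. -/
theorem trace_sq_pow_exterior {V ι : Type*} [AddCommGroup V] [Module ℂ V] [Fintype ι]
    [DecidableEq ι] (v : ι → ι → V) (k : ℕ) (hk : 0 < k)
    (X : Matrix ι ι (ExteriorAlgebra ℂ V)) (hX : ∀ i j, X i j = ExteriorAlgebra.ι ℂ (v i j)) :
    ((X * X) ^ k).trace = 0 := by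
  obtain ⟨k, rfl⟩ := Nat.exists_eq_succ_of_ne_zero hk.ne'
  have hanti : ∀ a b c d, X a b * X c d = -(X c d * X a b) := by
    intro a b c d
    rw [hX, hX]
    exact eq_neg_of_add_eq_zero_left (ExteriorAlgebra.ι_add_mul_swap _ _)
  have hXX : ∀ i j, (X * X) i j ∈ Subalgebra.center ℂ (ExteriorAlgebra ℂ V) := by
    intro i j
    rw [Matrix.mul_apply]
    refine Subalgebra.sum_mem _ fun l _ => ?_
    rw [hX, hX]
    exact mem_center_exteriorAlgebra _ _
  have hpow : ∀ m i j, ((X * X) ^ m) i j ∈ Subalgebra.center ℂ (ExteriorAlgebra ℂ V) := by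
    intro m
    induction m with
    | zero =>
      intro i j
      rw [pow_zero, Matrix.one_apply]
      split_ifs
      · exact Subalgebra.one_mem _
      · exact Subalgebra.zero_mem _
    | succ m ih =>
      intro i j
      rw [pow_succ, Matrix.mul_apply]
      exact Subalgebra.sum_mem _ fun l _ => Subalgebra.mul_mem _ (ih _ _) (hXX _ _)
  have hcm : Commute X ((X * X) ^ k) := ((Commute.refl X).mul_right (Commute.refl X)).pow_right k
  set Y := X * (X * X) ^ k with hY
  have h1 : (X * X) ^ (k + 1) = X * Y := by rw [hY, pow_succ', mul_assoc]
  have h2 : (X * X) ^ (k + 1) = Y * X := by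
    rw [hY, pow_succ, hcm.eq, mul_assoc]
  -- The entries of `Y` are generators times central elements, so they anticommute with those of
  -- `X`, and cyclicity of the trace holds with a minus sign. As `X` and `Y` commute as matrices,
  -- the trace equals its own negative.
  have h3 : (X * Y).trace = -(Y * X).trace := by
    simp only [Matrix.trace, Matrix.diag_apply, Matrix.mul_apply (M := X) (N := Y),
      Matrix.mul_apply (M := Y) (N := X)]
    rw [Finset.sum_comm, ← Finset.sum_neg_distrib]
    refine Finset.sum_congr rfl fun j _ => ?_
    rw [← Finset.sum_neg_distrib]
    refine Finset.sum_congr rfl fun i _ => ?_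
    rw [hY, Matrix.mul_apply, Finset.mul_sum, Finset.sum_mul, ← Finset.sum_neg_distrib]
    refine Finset.sum_congr rfl fun c _ => ?_
    have := Subalgebra.mem_center_iff.1 (hpow k c i) (X i j)
    rw [mul_assoc, ← this, ← mul_assoc, ← mul_assoc, hanti, neg_mul]
  rw [Nat.succ_eq_add_one]
  have h4 : ((X * X) ^ (k + 1)).trace = -((X * X) ^ (k + 1)).trace := by
    conv_lhs => rw [h1, h3, ← h2]
  have h5 : (2 : ℂ) • ((X * X) ^ (k + 1)).trace = 0 := by
    rw [two_smul]
    nth_rewrite 1 [h4]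
    exact neg_add_cancel _
  exact (smul_eq_zero.1 h5).resolve_left two_ne_zero

/-- The square of a matrix of size `n` with entries in the generating space of an exterior algebra
has vanishing `n`-th power. -/
theorem sq_pow_card_eq_zero_exterior {V ι : Type*} [AddCommGroup V] [Module ℂ V] [Fintype ι]
    [DecidableEq ι] (v : ι → ι → V) (X : Matrix ι ι (ExteriorAlgebra ℂ V))
    (hX : ∀ i j, X i j = ExteriorAlgebra.ι ℂ (v i j)) :
    (X * X) ^ Fintype.card ι = 0 := by
  set S := Subalgebra.center ℂ (ExteriorAlgebra ℂ V)
  have hXX : ∀ i j, (X * X) i j ∈ S := by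
    intro i j
    rw [Matrix.mul_apply]
    refine Subalgebra.sum_mem _ fun l _ => ?_
    rw [hX, hX]
    exact mem_center_exteriorAlgebra _ _
  -- Over the centre, which is commutative, the nilpotency criterion applies.
  let M : Matrix ι ι S := Matrix.of fun i j => ⟨(X * X) i j, hXX i j⟩
  have hM : S.val.toRingHom.mapMatrix M = X * X := by
    ext i j
    rfl
  let _ : Algebra ℚ S := ((algebraMap ℂ S).comp (algebraMap ℚ ℂ)).toAlgebra
  have h := pow_card_eq_zero_of_trace_pow M (fun k hk => by
    apply Subtype.val_injective
    have h1 := trace_sq_pow_exterior v k hk X hX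
    rw [← hM, ← map_pow] at h1
    rw [← S.coe_val]
    rw [map_zero, ← h1]
    exact AddMonoidHom.map_trace S.val.toRingHom.toAddMonoidHom _)
  rw [← hM, ← map_pow, h, map_zero]

/-- **Amitsur–Levitzki**: square matrices of size `n` satisfy the standard polynomial identity of
every degree `N ≥ 2 n`. -/
theorem sum_sign_smul_prod_eq_zero {ι : Type*} [Fintype ι] [DecidableEq ι] {N : ℕ}
    (hN : 2 * Fintype.card ι ≤ N) (Y : Fin N → Matrix ι ι ℂ) :
    ∑ π : Equiv.Perm (Fin N),
      ((Equiv.Perm.sign π : ℤ) : ℂ) • (List.ofFn fun q => Y (π q)).prod = 0 := by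
  let e : Fin N → (Fin N → ℂ) := fun q => Pi.single q 1
  -- For `X = ∑ Y_q e_q`, the coefficient of `e₁ ∧ ⋯ ∧ e_N` in `X^N` is the standard polynomial in
  -- the `Y_q`.
  let X : Matrix ι ι (ExteriorAlgebra ℂ (Fin N → ℂ)) :=
    Matrix.of fun i j => ExteriorAlgebra.ι ℂ (∑ q, Y q i j • e q)
  have hX2 : X ^ N = 0 := by
    refine (congrArg (X ^ ·) (Nat.add_sub_of_le hN).symm).trans ?_
    rw [pow_add, pow_mul, pow_two,
      sq_pow_card_eq_zero_exterior (fun i j => ∑ q, Y q i j • e q) X (fun i j => rfl), zero_mul]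
  have hexp : ∀ (l : ℕ) (a b : ι), (X ^ l) a b =
      ∑ f : Fin l → Fin N, (List.ofFn fun j => Y (f j)).prod a b •
        (List.ofFn fun j => ExteriorAlgebra.ι ℂ (e (f j))).prod := by
    intro l
    induction l with
    | zero =>
      intro a b
      simp only [pow_zero, List.ofFn_zero, List.prod_nil, Finset.univ_unique, Finset.sum_singleton,
        Matrix.one_apply]
      split_ifs <;> simp
    | succ l ih =>
      intro a b
      rw [pow_succ', Matrix.mul_apply, sum_fin_cons]
      simp only [List.ofFn_succ, Fin.cons_zero, Fin.cons_succ, List.prod_cons, Matrix.mul_apply,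
        Finset.sum_smul]
      have h1 : ∀ c, X a c = ∑ q, Y q a c • ExteriorAlgebra.ι ℂ (e q) := by
        intro c
        simp only [X, Matrix.of_apply, map_sum, map_smul]
      simp only [ih, h1, Finset.sum_mul, Finset.mul_sum, smul_mul_smul_comm]
      rw [Finset.sum_comm]
      exact (Finset.sum_congr rfl fun f _ => Finset.sum_comm).trans Finset.sum_comm
  -- This functional reads off the top coefficient: the determinant in degree `N`, zero in all other
  -- degrees.
  let φ := ExteriorAlgebra.liftAlternating (R := ℂ) (M := Fin N → ℂ) (N := ℂ)
    (Function.update 0 N Matrix.detRowAlternating)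
  have hφ : ∀ f : Fin N → Fin N, φ (List.ofFn fun j => ExteriorAlgebra.ι ℂ (e (f j))).prod =
      Matrix.detRowAlternating (fun j => e (f j)) := by
    intro f
    rw [← ExteriorAlgebra.ιMulti_apply (R := ℂ) (v := fun j => e (f j))]
    simp only [φ]
    rw [ExteriorAlgebra.liftAlternating_apply_ιMulti, Function.update_self]
  ext a b
  have h1 := congrArg φ (hexp N a b)
  rw [hX2, Matrix.zero_apply, map_zero, map_sum] at h1
  simp only [map_smul, hφ] at h1
  rw [Matrix.sum_apply, Matrix.zero_apply, h1]
  refine Finset.sum_of_injOn (fun π => ⇑π) (fun π _ σ _ h => DFunLike.coe_injective h)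
    (fun _ _ => Finset.mem_coe.2 (Finset.mem_univ _)) ?_ ?_
  · intro f _ hf
    rw [AlternatingMap.map_eq_zero_of_not_injective, smul_zero]
    intro hinj
    have hi : Function.Injective f := fun x y h => hinj (by simp only [h])
    exact hf ⟨Equiv.ofBijective f (Finite.injective_iff_bijective.1 hi), by simp, rfl⟩
  · intro π _
    have := AlternatingMap.map_perm (Matrix.detRowAlternating (R := ℂ)) e π
    have h2 : Matrix.detRowAlternating (R := ℂ) e = 1 := by
      have : e = (1 : Matrix (Fin N) (Fin N) ℂ) := by
        ext i j
        simp [e, Matrix.one_apply, Pi.single_apply, eq_comm]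
      rw [this]
      exact Matrix.det_one
    rw [h2] at this
    have h3 : Matrix.detRowAlternating (R := ℂ) (fun j => e (π j)) =
        ((Equiv.Perm.sign π : ℤ) : ℂ) := by
      refine Eq.trans this ?_
      simp [Units.smul_def]
    rw [Matrix.smul_apply, h3, smul_eq_mul, mul_comm, smul_eq_mul]

/-- The real quadratic form `φ ↦ Re ⟨φ|h|φ⟩`. -/
noncomputable def form {ι : Type*} [Fintype ι] (h : Matrix ι ι ℂ) (φ : ι → ℂ) : ℝ :=
  (star φ ⬝ᵥ h.mulVec φ).re

/-- The squared norm `⟨φ|φ⟩`. -/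
noncomputable def nsq {ι : Type*} [Fintype ι] (φ : ι → ℂ) : ℝ :=
  (star φ ⬝ᵥ φ).re

/-! ### Windows of sites on the ring. -/

section window

variable {α : Type*} {n k : ℕ}

/-- The site at distance `l` to the right of `j`. -/
def site (j : Fin n) (l : ℕ) : Fin n := ⟨(j + l) % n, Nat.mod_lt _ j.pos⟩

/-- The distance from `j` rightwards to `i`. -/
def offset (j i : Fin n) : ℕ := if (j : ℕ) ≤ i then i - j else i + n - j

theorem offset_lt (j i : Fin n) : offset j i < n := by
  unfold offset
  split_ifs <;> omega

theorem site_val (j : Fin n) {l : ℕ} (hl : l < n) :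
    (site j l : ℕ) = if (j : ℕ) + l < n then (j : ℕ) + l else j + l - n := by
  unfold site
  simp only
  split_ifs with h
  · exact Nat.mod_eq_of_lt h
  · rw [Nat.mod_eq_sub_mod (by omega), Nat.mod_eq_of_lt (by omega)]

theorem offset_site (j : Fin n) {l : ℕ} (hl : l < n) : offset j (site j l) = l := by
  unfold offset
  rw [site_val j hl]
  split_ifs <;> omega

theorem site_offset (j i : Fin n) : site j (offset j i) = i := by
  apply Fin.ext
  rw [site_val j (offset_lt j i)]
  unfold offset
  split_ifs <;> omega

theorem mem_window_iff (hk : k ≤ n) (j i : Fin n) : i ∈ window k j ↔ offset j i < k := by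
  constructor
  · rintro ⟨l, hl, h⟩
    have : i = site j l := Fin.ext h
    rw [this, offset_site j (by omega)]
    exact hl
  · intro h
    exact ⟨offset j i, h, congrArg Fin.val (site_offset j i).symm⟩

/-- The configuration `x` read in the window of `k` sites that starts at `j`. -/
def readAt (k : ℕ) (j : Fin n) (x : Fin n → α) : Fin k → α := fun l => x (site j l)

/-- The configuration `x` with the window of `k` sites that starts at `j` overwritten by `u`. -/
def putAt (j : Fin n) (x : Fin n → α) (u : Fin k → α) : Fin n → α :=
  fun i => if h : offset j i < k then u ⟨offset j i, h⟩ else x i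

theorem readAt_putAt (hk : k ≤ n) (j : Fin n) (x : Fin n → α) (u : Fin k → α) :
    readAt k j (putAt j x u) = u := by
  funext l
  have := offset_site j (l := l) (by omega)
  simp only [readAt, putAt, this, l.2, dite_true]

theorem putAt_putAt (j : Fin n) (x : Fin n → α) (u v : Fin k → α) :
    putAt j (putAt j x u) v = putAt j x v := by
  funext i
  unfold putAt
  split_ifs <;> rfl

theorem putAt_readAt (j : Fin n) (x : Fin n → α) : putAt j x (readAt k j x) = x := by
  funext i
  unfold putAt readAt
  split_ifs
  · simp only [site_offset]
  · rfl

theorem putAt_eq_of_agree (hk : k ≤ n) (j : Fin n) (x y : Fin n → α)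
    (h : ∀ i, i ∉ window k j → x i = y i) : putAt j x (readAt k j y) = y := by
  funext i
  unfold putAt readAt
  split_ifs with hi
  · simp only [site_offset]
  · exact h i (fun hm => hi ((mem_window_iff hk j i).1 hm))

theorem putAt_agree (hk : k ≤ n) (j : Fin n) (x : Fin n → α) (u : Fin k → α) (i : Fin n)
    (hi : i ∉ window k j) : x i = putAt j x u i := by
  rw [mem_window_iff hk] at hi
  simp [putAt, hi]

/-- Swapping `u` with the content of the window is an involution on the pairs `(x, u)`, after which
the summand no longer depends on `u`. -/
theorem sum_sum_putAt [Fintype α] {M : Type*} [AddCommMonoid M] (hk : k ≤ n) (j : Fin n)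
    (F : (Fin n → α) → M) :
    ∑ x, ∑ u : Fin k → α, F (putAt j x u) = Fintype.card (Fin k → α) • ∑ x, F x := by
  have e : Function.Involutive
      (fun p : (Fin n → α) × (Fin k → α) => (putAt j p.1 p.2, readAt k j p.1)) := by
    rintro ⟨x, u⟩
    simp only [putAt_putAt, readAt_putAt hk, putAt_readAt]
  rw [← Fintype.sum_prod_type', ← Equiv.sum_comp (Function.Involutive.toPerm _ e)]
  have : ∀ p : (Fin n → α) × (Fin k → α),
      F (putAt j ((Function.Involutive.toPerm _ e) p).1 ((Function.Involutive.toPerm _ e) p).2) = F p.1 := by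
    rintro ⟨x, u⟩
    change F (putAt j (putAt j x u) (readAt k j x)) = F x
    rw [putAt_putAt, putAt_readAt]
  simp only [this]
  rw [Fintype.sum_prod_type]
  simp [Finset.smul_sum]

end window

/-! ### Translates of a local operator and the Hamiltonian they form. -/

section localOp

variable {d n k : ℕ}

open Classical in
/-- The operator `h` applied to the window of `k` sites that starts at `j`. -/
noncomputable def localOp (j : Fin n) (h : Matrix (Fin k → Fin d) (Fin k → Fin d) ℂ) :
    Matrix (Fin n → Fin d) (Fin n → Fin d) ℂ :=
  Matrix.of fun x y =>
    if ∀ i, i ∉ window k j → x i = y i then h (readAt k j x) (readAt k j y) else 0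

/-- The restriction of the vector `ψ` to a window, with the other particles in the basis state
given by `x`. -/
def slice (k : ℕ) (j : Fin n) (x : Fin n → Fin d) (ψ : (Fin n → Fin d) → ℂ) :
    (Fin k → Fin d) → ℂ :=
  fun u => ψ (putAt j x u)

theorem localOp_apply_of_agree {j : Fin n} {x y : Fin n → Fin d}
    (h : Matrix (Fin k → Fin d) (Fin k → Fin d) ℂ) (hxy : ∀ i, i ∉ window k j → x i = y i) :
    localOp j h x y = h (readAt k j x) (readAt k j y) := if_pos hxy

theorem localOp_apply_of_not_agree {j : Fin n} {x y : Fin n → Fin d}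
    (h : Matrix (Fin k → Fin d) (Fin k → Fin d) ℂ) (hxy : ¬∀ i, i ∉ window k j → x i = y i) :
    localOp j h x y = 0 := if_neg hxy

theorem slice_putAt (j : Fin n) (x : Fin n → Fin d) (u : Fin k → Fin d)
    (ψ : (Fin n → Fin d) → ℂ) : slice k j (putAt j x u) ψ = slice k j x ψ := by
  funext v
  simp only [slice, putAt_putAt]

theorem localOp_mulVec (hk : k ≤ n) (j : Fin n) (h : Matrix (Fin k → Fin d) (Fin k → Fin d) ℂ)
    (ψ : (Fin n → Fin d) → ℂ) (x : Fin n → Fin d) :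
    (localOp j h).mulVec ψ x = h.mulVec (slice k j x ψ) (readAt k j x) := by
  classical
  simp only [Matrix.mulVec, dotProduct]
  symm
  refine Finset.sum_of_injOn (fun u => putAt j x u) ?_
    (fun _ _ => Finset.mem_coe.2 (Finset.mem_univ _)) ?_ ?_
  · intro u _ v _ huv
    have := congrArg (readAt k j) huv
    simpa only [readAt_putAt hk] using this
  · intro y _ hy
    rw [localOp_apply_of_not_agree, zero_mul]
    intro hag
    exact hy ⟨readAt k j y, by simp, putAt_eq_of_agree hk j x y hag⟩
  · intro u _
    rw [localOp_apply_of_agree _ (fun i hi => putAt_agree hk j x u i hi), readAt_putAt hk]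
    rfl

/-- A slice depends only on the letters of `x` outside the window. Summing over all `x` counts each
slice once per content of the window, which is the factor on the left; this avoids splitting off a
tensor factor. -/
theorem card_mul_form_localOp (hk : k ≤ n) (j : Fin n)
    (h : Matrix (Fin k → Fin d) (Fin k → Fin d) ℂ) (ψ : (Fin n → Fin d) → ℂ) :
    (Fintype.card (Fin k → Fin d) : ℝ) * form (localOp j h) ψ =
      ∑ x, form h (slice k j x ψ) := by
  have h1 := sum_sum_putAt hk j (fun x => (star (ψ x) * (localOp j h).mulVec ψ x).re)
  rw [nsmul_eq_mul] at h1
  have h2 : form (localOp j h) ψ = ∑ x, (star (ψ x) * (localOp j h).mulVec ψ x).re := by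
    simp only [form, dotProduct, Pi.star_apply, Complex.re_sum]
  rw [h2, ← h1]
  refine Finset.sum_congr rfl fun x _ => ?_
  simp only [form, dotProduct, Pi.star_apply, Complex.re_sum]
  refine Finset.sum_congr rfl fun u _ => ?_
  rw [localOp_mulVec hk, readAt_putAt hk, slice_putAt]
  rfl

theorem card_mul_nsq (hk : k ≤ n) (j : Fin n) (ψ : (Fin n → Fin d) → ℂ) :
    (Fintype.card (Fin k → Fin d) : ℝ) * nsq ψ = ∑ x, nsq (slice k j x ψ) := by
  have h1 := sum_sum_putAt hk j (fun x => (star (ψ x) * ψ x).re)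
  rw [nsmul_eq_mul] at h1
  simp only [nsq, dotProduct, Pi.star_apply, Complex.re_sum]
  rw [← h1]
  rfl

/-- The translation-invariant Hamiltonian that is the sum of all the translates of `h`. -/
noncomputable def chainHamiltonian (n : ℕ) (h : Matrix (Fin k → Fin d) (Fin k → Fin d) ℂ) :
    Matrix (Fin n → Fin d) (Fin n → Fin d) ℂ :=
  ∑ j : Fin n, localOp j h

theorem form_chainHamiltonian (h : Matrix (Fin k → Fin d) (Fin k → Fin d) ℂ)
    (ψ : (Fin n → Fin d) → ℂ) :
    form (chainHamiltonian n h) ψ = ∑ j, form (localOp j h) ψ := by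
  simp only [form, chainHamiltonian, Matrix.sum_mulVec, dotProduct_sum, Complex.re_sum]

theorem isLocalHamiltonian_chainHamiltonian (hk : k ≤ n)
    {h : Matrix (Fin k → Fin d) (Fin k → Fin d) ℂ} (hh : h.IsHermitian) :
    IsLocalHamiltonian k (chainHamiltonian n h) := by
  classical
  refine ⟨hk, fun j => localOp j h, fun j => ⟨?_, ?_⟩, rfl⟩
  · ext x y
    rw [Matrix.conjTranspose_apply]
    beta_reduce
    by_cases hxy : ∀ i, i ∉ window k j → x i = y i
    · rw [localOp_apply_of_agree h hxy, localOp_apply_of_agree h (fun i hi => (hxy i hi).symm)]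
      exact hh.apply _ _
    · rw [localOp_apply_of_not_agree h hxy,
        localOp_apply_of_not_agree h (fun h' => hxy fun i hi => (h' i hi).symm), star_zero]
  · refine ⟨Matrix.of fun a b => h (fun l => a ⟨site j l, ⟨l, l.2, rfl⟩⟩)
      (fun l => b ⟨site j l, ⟨l, l.2, rfl⟩⟩), ?_, ?_⟩
    · intro x y hxy
      exact localOp_apply_of_agree h hxy
    · rintro x y ⟨i, hi, hxy⟩
      exact localOp_apply_of_not_agree h (fun h' => hxy (h' i hi))

theorem isTranslationInvariant_chainHamiltonian
    (h : Matrix (Fin k → Fin d) (Fin k → Fin d) ℂ) :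
    IsTranslationInvariant (chainHamiltonian n h) := by
  classical
  intro x y
  rcases n with _ | m
  · exact congrArg₂ _ (Subsingleton.elim _ _) (Subsingleton.elim _ _)
  have hsite : ∀ (j : Fin (m + 1)) (l : ℕ), finRotate (m + 1) (site j l) =
      site (finRotate (m + 1) j) l := by
    intro j l
    apply Fin.ext
    simp only [finRotate_apply, Fin.val_add, site, Fin.val_one', Nat.add_mod_mod, Nat.mod_add_mod]
    congr 1
    ring
  have hw : ∀ (j i : Fin (m + 1)), finRotate (m + 1) i ∈ window k (finRotate (m + 1) j) ↔
      i ∈ window k j := by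
    intro j i
    constructor
    · rintro ⟨l, hl, h1⟩
      have h2 : finRotate (m + 1) i = finRotate (m + 1) (site j l) := by
        rw [hsite]
        exact Fin.ext h1
      exact ⟨l, hl, congrArg Fin.val ((finRotate (m + 1)).injective h2)⟩
    · rintro ⟨l, hl, h1⟩
      have h2 : i = site j l := Fin.ext h1
      refine ⟨l, hl, ?_⟩
      rw [h2, hsite]
      rfl
  simp only [chainHamiltonian, Matrix.sum_apply]
  rw [← Equiv.sum_comp (finRotate (m + 1)) fun j => localOp j h x y]
  refine Finset.sum_congr rfl fun j _ => ?_
  have hr : ∀ z : Fin (m + 1) → Fin d, readAt k j (z ∘ finRotate (m + 1)) =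
      readAt k (finRotate (m + 1) j) z := by
    intro z
    funext l
    simp only [readAt, Function.comp_apply, hsite]
  have hiff : (∀ i, i ∉ window k j → (x ∘ finRotate (m + 1)) i = (y ∘ finRotate (m + 1)) i) ↔
      ∀ i, i ∉ window k (finRotate (m + 1) j) → x i = y i := by
    constructor
    · intro h1 i hi
      obtain ⟨i, rfl⟩ := (finRotate (m + 1)).surjective i
      exact h1 i (fun h2 => hi ((hw j i).2 h2))
    · intro h1 i hi
      exact h1 _ (fun h2 => hi ((hw j i).1 h2))
  by_cases hxy : ∀ i, i ∉ window k (finRotate (m + 1) j) → x i = y i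
  · rw [localOp_apply_of_agree h hxy, localOp_apply_of_agree h (hiff.2 hxy), hr, hr]
  · rw [localOp_apply_of_not_agree h hxy,
      localOp_apply_of_not_agree h (fun h' => hxy (hiff.1 h'))]

end localOp

/-! ### Words and the standard polynomial as a vector. -/

section words

variable {b d : ℕ}

/-- The product of the matrices of `A` along a list of letters. -/
noncomputable def listWord (A : Fin d → Matrix (Fin b) (Fin b) ℂ) (l : List (Fin d)) :
    Matrix (Fin b) (Fin b) ℂ :=
  (l.map A).prod

@[simp]
theorem listWord_nil (A : Fin d → Matrix (Fin b) (Fin b) ℂ) : listWord A [] = 1 := rfl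

@[simp]
theorem listWord_append (A : Fin d → Matrix (Fin b) (Fin b) ℂ) (l l' : List (Fin d)) :
    listWord A (l ++ l') = listWord A l * listWord A l' := by
  simp [listWord]

@[simp]
theorem listWord_cons (A : Fin d → Matrix (Fin b) (Fin b) ℂ) (a : Fin d) (l : List (Fin d)) :
    listWord A (a :: l) = A a * listWord A l := by
  simp [listWord]

theorem word_eq_listWord {n : ℕ} (A : Fin d → Matrix (Fin b) (Fin b) ℂ) (u : Fin n → Fin d) :
    word A u = listWord A (List.ofFn u) := by
  rw [listWord, List.map_ofFn]
  rfl

/-- The concatenation of the words `X q`, permuted by `π`. -/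
def shuffle {N : ℕ} (X : Fin N → List (Fin d)) (π : Equiv.Perm (Fin N)) : List (Fin d) :=
  (List.ofFn fun q => X (π q)).flatten

theorem length_shuffle {N : ℕ} (X : Fin N → List (Fin d)) (π : Equiv.Perm (Fin N)) :
    (shuffle X π).length = ∑ q, (X q).length := by
  rw [shuffle, List.length_flatten, List.map_ofFn, List.sum_ofFn]
  exact Equiv.sum_comp π fun q => (X q).length

theorem listWord_shuffle {N : ℕ} (A : Fin d → Matrix (Fin b) (Fin b) ℂ)
    (X : Fin N → List (Fin d)) (π : Equiv.Perm (Fin N)) :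
    listWord A (shuffle X π) = (List.ofFn fun q => listWord A (X (π q))).prod := by
  rw [listWord, shuffle, List.map_flatten, List.prod_flatten, List.map_ofFn, List.map_ofFn]
  rfl

/-- The sign of a permutation as a complex number. -/
def csign {N : ℕ} (π : Equiv.Perm (Fin N)) : ℂ := ((Equiv.Perm.sign π : ℤ) : ℂ)

theorem sum_csign_smul_listWord_shuffle {N : ℕ} (hN : 2 * b ≤ N)
    (A : Fin d → Matrix (Fin b) (Fin b) ℂ) (X : Fin N → List (Fin d)) :
    ∑ π, csign π • listWord A (shuffle X π) = 0 := by
  simp only [listWord_shuffle]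
  exact sum_sign_smul_prod_eq_zero (by simpa using hN) fun q => listWord A (X q)

theorem sum_csign_mul_trace {N : ℕ} (hN : 2 * b ≤ N) (A : Fin d → Matrix (Fin b) (Fin b) ℂ)
    (X : Fin N → List (Fin d)) (P Q : Matrix (Fin b) (Fin b) ℂ) :
    ∑ π, csign π * (P * listWord A (shuffle X π) * Q).trace = 0 := by
  have h := congrArg (fun M => (P * M * Q).trace) (sum_csign_smul_listWord_shuffle hN A X)
  simpa only [Finset.mul_sum, Finset.sum_mul, Matrix.trace_sum, Matrix.mul_smul, Matrix.smul_mul,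
    Matrix.trace_smul, smul_eq_mul, Matrix.mul_zero, Matrix.zero_mul, Matrix.trace_zero] using h

/-- The basis vector of the configuration given by a list. -/
def listVec (k : ℕ) (L : List (Fin d)) : (Fin k → Fin d) → ℂ :=
  fun u => if List.ofFn u = L then 1 else 0

theorem star_listVec (k : ℕ) (L : List (Fin d)) : star (listVec k L) = listVec k L := by
  funext u
  simp only [listVec, Pi.star_apply]
  split_ifs <;> simp

theorem listVec_dotProduct {k : ℕ} {L : List (Fin d)} (hL : L.length = k)
    (F : List (Fin d) → ℂ) : listVec k L ⬝ᵥ (fun u => F (List.ofFn u)) = F L := by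
  subst hL
  rw [dotProduct, Finset.sum_eq_single (fun i => L.get i)]
  · rw [listVec, List.ofFn_get, if_pos rfl, one_mul]
  · intro u _ hu
    rw [listVec, if_neg, zero_mul]
    rintro h
    apply hu
    apply List.ofFn_injective
    rw [h, List.ofFn_get]
  · simp

/-- The double standard polynomial `S(X) R S(X) R` in the words `X` as a vector. -/
def doubleStandard {N : ℕ} (k : ℕ) (X : Fin N → List (Fin d)) (R : List (Fin d)) :
    (Fin k → Fin d) → ℂ :=
  ∑ π, ∑ π', (csign π * csign π') • listVec k (shuffle X π ++ R ++ (shuffle X π' ++ R))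

theorem star_csign {N : ℕ} (π : Equiv.Perm (Fin N)) : star (csign π) = csign π := by
  simp [csign]

theorem star_doubleStandard_dotProduct {N k : ℕ} {X : Fin N → List (Fin d)} {R : List (Fin d)}
    (hk : k = 2 * ((shuffle X 1).length + R.length)) (F : List (Fin d) → ℂ) :
    star (doubleStandard k X R) ⬝ᵥ (fun u => F (List.ofFn u)) =
      ∑ π, ∑ π', csign π * csign π' * F (shuffle X π ++ R ++ (shuffle X π' ++ R)) := by
  simp only [doubleStandard, star_sum, sum_dotProduct, star_smul, smul_dotProduct, star_listVec]
  refine Finset.sum_congr rfl fun π _ => Finset.sum_congr rfl fun π' _ => ?_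
  rw [listVec_dotProduct, smul_eq_mul, star_mul, star_csign, star_csign, mul_comm (csign π')]
  rw [hk]
  simp only [List.length_append, length_shuffle]
  ring

end words

/-! ### Restrictions of matrix product states to windows. -/

section slices

variable {b d n k : ℕ}

/-- Vectors on `k` sites that arise from matrix product states with a matrix `ω'` inserted at some
bond. -/
def IsCut (A : Fin d → Matrix (Fin b) (Fin b) ℂ) (φ : (Fin k → Fin d) → ℂ) : Prop :=
  ∃ (C ω' : Matrix (Fin b) (Fin b) ℂ) (m : ℕ), φ = fun u => (C *
    (listWord A ((List.ofFn u).take m) * ω' * listWord A ((List.ofFn u).drop m))).trace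

/-- Vectors on `k` sites that arise from matrix product states without an insertion. -/
def IsUncut (A : Fin d → Matrix (Fin b) (Fin b) ℂ) (φ : (Fin k → Fin d) → ℂ) : Prop :=
  ∃ C : Matrix (Fin b) (Fin b) ℂ, φ = fun u => (C * listWord A (List.ofFn u)).trace

theorem IsUncut.isCut {A : Fin d → Matrix (Fin b) (Fin b) ℂ} {φ : (Fin k → Fin d) → ℂ}
    (h : IsUncut A φ) : IsCut A φ := by
  obtain ⟨C, rfl⟩ := h
  exact ⟨C, 1, 0, by simp⟩

theorem ofFn_putAt_of_le {α : Type*} (j : Fin n) (x : Fin n → α) (u : Fin k → α)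
    (h : (j : ℕ) + k ≤ n) : List.ofFn (putAt j x u) =
      (List.ofFn x).take j ++ (List.ofFn u ++ (List.ofFn x).drop (j + k)) := by
  apply List.ext_getElem
  · simp
    omega
  · intro i h1 h2
    rw [List.length_ofFn] at h1
    simp only [List.getElem_ofFn, List.getElem_append, List.length_take, List.length_ofFn,
      List.getElem_take, List.getElem_drop, putAt, offset]
    have hj := j.2
    repeat' split
    all_goals first | omega | rfl | (refine congrArg _ (Fin.ext ?_); simp only; omega)

/-- Here the window wraps around: its first `n - j` letters end the chain and the others begin it,
so `ω` sits between letters `n - j` and `n - j + 1` of the window. -/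
theorem ofFn_putAt_of_lt {α : Type*} (hk : k ≤ n) (j : Fin n) (x : Fin n → α) (u : Fin k → α)
    (h : n < (j : ℕ) + k) : List.ofFn (putAt j x u) =
      (List.ofFn u).drop (n - j) ++ (((List.ofFn x).drop (j + k - n)).take (n - k) ++
        (List.ofFn u).take (n - j)) := by
  apply List.ext_getElem
  · simp
    omega
  · intro i h1 h2
    rw [List.length_ofFn] at h1
    simp only [List.getElem_ofFn, List.getElem_append, List.length_take, List.length_drop,
      List.length_ofFn, List.getElem_take, List.getElem_drop, putAt, offset]
    have hj := j.2
    repeat' split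
    all_goals first | omega | (refine congrArg _ (Fin.ext ?_); simp only; omega)

theorem isUncut_slice_of_le (A : Fin d → Matrix (Fin b) (Fin b) ℂ)
    (ω : Matrix (Fin b) (Fin b) ℂ) (j : Fin n) (x : Fin n → Fin d) (h : (j : ℕ) + k ≤ n) :
    IsUncut A (slice k j x (mps n ω A)) := by
  refine ⟨listWord A ((List.ofFn x).drop (j + k)) * ω * listWord A ((List.ofFn x).take j), ?_⟩
  funext u
  rw [slice, mps, word_eq_listWord, ofFn_putAt_of_le j x u h, listWord_append, listWord_append]
  rw [← mul_assoc, ← mul_assoc, Matrix.trace_mul_comm]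
  simp only [mul_assoc]

theorem isCut_slice (hk : k ≤ n) (A : Fin d → Matrix (Fin b) (Fin b) ℂ)
    (ω : Matrix (Fin b) (Fin b) ℂ) (j : Fin n) (x : Fin n → Fin d) :
    IsCut A (slice k j x (mps n ω A)) ∧ (ω = 1 → IsUncut A (slice k j x (mps n ω A))) := by
  rcases le_or_gt ((j : ℕ) + k) n with h | h
  · exact ⟨(isUncut_slice_of_le A ω j x h).isCut, fun _ => isUncut_slice_of_le A ω j x h⟩
  · have key : ∀ u : Fin k → Fin d, slice k j x (mps n ω A) u =
        (listWord A (((List.ofFn x).drop (j + k - n)).take (n - k)) *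
          (listWord A ((List.ofFn u).take (n - j)) * ω *
            listWord A ((List.ofFn u).drop (n - j)))).trace := by
      intro u
      rw [slice, mps, word_eq_listWord, ofFn_putAt_of_lt hk j x u h, listWord_append,
        listWord_append, ← mul_assoc, Matrix.trace_mul_comm]
      simp only [mul_assoc]
    refine ⟨⟨_, ω, n - j, funext key⟩, fun h1 =>
      ⟨listWord A (((List.ofFn x).drop (j + k - n)).take (n - k)), funext fun u => ?_⟩⟩
    rw [key u, h1, mul_one, ← listWord_append, List.take_append_drop]

/-- The insertion after letter `m` lies in at most one of the two halves `S(X) R`. The other half is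
undisturbed, and its alternating sum vanishes by Amitsur–Levitzki. -/
theorem star_doubleStandard_dotProduct_isCut {N : ℕ} (hN : 2 * b ≤ N)
    {X : Fin N → List (Fin d)} {R : List (Fin d)}
    (hk : k = 2 * ((shuffle X 1).length + R.length)) {A : Fin d → Matrix (Fin b) (Fin b) ℂ}
    {φ : (Fin k → Fin d) → ℂ} (hφ : IsCut A φ) : star (doubleStandard k X R) ⬝ᵥ φ = 0 := by
  obtain ⟨C, ω', m, rfl⟩ := hφ
  rw [star_doubleStandard_dotProduct hk fun l =>
    (C * (listWord A (l.take m) * ω' * listWord A (l.drop m))).trace]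
  have hlen : ∀ π, (shuffle X π ++ R).length = (shuffle X 1).length + R.length := by
    intro π
    rw [List.length_append, length_shuffle, length_shuffle]
  rcases le_or_gt m ((shuffle X 1).length + R.length) with hm | hm
  -- The cut is in the first half, so the sum over `π'` in the second half vanishes for each `π`.
  · refine Finset.sum_eq_zero fun π _ => ?_
    have := sum_csign_mul_trace hN A X (C * (listWord A ((shuffle X π ++ R).take m) * ω' *
      listWord A ((shuffle X π ++ R).drop m))) (listWord A R)
    simp only [mul_assoc (csign π)]
    rw [← Finset.mul_sum]
    convert mul_zero (csign π) using 2
    rw [← this]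
    refine Finset.sum_congr rfl fun π' _ => ?_
    rw [List.take_append_of_le_length (by rw [hlen]; exact hm),
      List.drop_append_of_le_length (by rw [hlen]; exact hm)]
    simp only [listWord_append, mul_assoc]
  -- The cut is in the second half, at distance `r` from its start; the roles of `π` and `π'` are
  -- exchanged.
  · rw [Finset.sum_comm]
    refine Finset.sum_eq_zero fun π' _ => ?_
    set r := m - ((shuffle X 1).length + R.length) with hr
    have := sum_csign_mul_trace hN A X C (listWord A R * listWord A ((shuffle X π' ++ R).take r)
      * ω' * listWord A ((shuffle X π' ++ R).drop r))
    simp only [mul_comm (csign _) (csign π'), mul_assoc (csign π')]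
    rw [← Finset.mul_sum]
    convert mul_zero (csign π') using 2
    rw [← this]
    refine Finset.sum_congr rfl fun π _ => ?_
    have hm' : m = (shuffle X π ++ R).length + r := by rw [hlen]; omega
    rw [hm', List.take_length_add_append, List.drop_length_add_append]
    simp only [listWord_append, mul_assoc]

end slices

open scoped ComplexOrder

/-! ### Quadratic forms, gaps and kernels. -/

section forms

variable {ι : Type*} [Fintype ι]

theorem nsq_eq_sum (φ : ι → ℂ) : nsq φ = ∑ i, ‖φ i‖ ^ 2 := by
  simp only [nsq, dotProduct, Complex.re_sum, Pi.star_apply]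
  refine Finset.sum_congr rfl fun i _ => ?_
  rw [← Complex.normSq_eq_norm_sq, Complex.star_def, ← Complex.normSq_eq_conj_mul_self,
    Complex.ofReal_re]

theorem nsq_nonneg (φ : ι → ℂ) : 0 ≤ nsq φ := by
  rw [nsq_eq_sum]
  positivity

theorem nsq_pos {φ : ι → ℂ} (h : φ ≠ 0) : 0 < nsq φ := by
  obtain ⟨i, hi⟩ := Function.ne_iff.1 h
  rw [nsq_eq_sum]
  exact Finset.sum_pos' (fun _ _ => by positivity)
    ⟨i, Finset.mem_univ _, by have := norm_pos_iff.2 hi; positivity⟩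

theorem nsq_smul (c : ℝ) (φ : ι → ℂ) : nsq ((c : ℂ) • φ) = c ^ 2 * nsq φ := by
  simp only [nsq_eq_sum, Pi.smul_apply, norm_smul, mul_pow, Finset.mul_sum, Complex.norm_real,
    Real.norm_eq_abs, sq_abs]

theorem form_smul (h : Matrix ι ι ℂ) (c : ℝ) (φ : ι → ℂ) :
    form h ((c : ℂ) • φ) = c ^ 2 * form h φ := by
  have : star ((c : ℂ) • φ) = (c : ℂ) • star φ := by
    rw [star_smul]
    simp
  rw [form, this, Matrix.mulVec_smul, smul_dotProduct, dotProduct_smul, smul_smul, smul_eq_mul,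
    ← Complex.ofReal_mul, Complex.re_ofReal_mul, pow_two]
  rfl

theorem form_nonneg {h : Matrix ι ι ℂ} (hh : h.PosSemidef) (φ : ι → ℂ) : 0 ≤ form h φ :=
  (Complex.le_def.1 (hh.dotProduct_mulVec_nonneg φ)).1

theorem mulVec_eq_zero_of_form {h : Matrix ι ι ℂ} (hh : h.PosSemidef) {φ : ι → ℂ}
    (h0 : form h φ = 0) : h.mulVec φ = 0 := by
  rw [← hh.dotProduct_mulVec_zero_iff]
  exact Complex.ext h0 (Complex.le_def.1 (hh.dotProduct_mulVec_nonneg φ)).2.symm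

theorem form_eq_zero_of_mulVec {h : Matrix ι ι ℂ} {φ : ι → ℂ} (h0 : h.mulVec φ = 0) :
    form h φ = 0 := by
  rw [form, h0, dotProduct_zero, Complex.zero_re]

theorem form_lower_bound (h : Matrix ι ι ℂ) : ∃ C : ℝ, ∀ φ : ι → ℂ, -C * nsq φ ≤ form h φ := by
  refine ⟨∑ i, ∑ j, ‖h i j‖, fun φ => ?_⟩
  have h1 : ‖star φ ⬝ᵥ h.mulVec φ‖ ≤ (∑ i, ∑ j, ‖h i j‖) * nsq φ := by
    simp only [dotProduct, Matrix.mulVec, Finset.mul_sum, Finset.sum_mul]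
    refine (norm_sum_le _ _).trans (Finset.sum_le_sum fun i _ => (norm_sum_le _ _).trans
      (Finset.sum_le_sum fun j _ => ?_))
    have hb : ∀ i, ‖φ i‖ ^ 2 ≤ nsq φ := fun i => by
      rw [nsq_eq_sum]
      exact Finset.single_le_sum (f := fun i => ‖φ i‖ ^ 2) (fun _ _ => by positivity)
        (Finset.mem_univ i)
    rw [norm_mul, norm_mul, Pi.star_apply, norm_star]
    have : ‖φ i‖ * ‖φ j‖ ≤ nsq φ := by nlinarith [hb i, hb j, sq_nonneg (‖φ i‖ - ‖φ j‖)]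
    nlinarith [mul_le_mul_of_nonneg_left this (norm_nonneg (h i j))]
  have h2 := (Complex.abs_re_le_norm (star φ ⬝ᵥ h.mulVec φ)).trans h1
  have h3 := neg_abs_le (star φ ⬝ᵥ h.mulVec φ).re
  change _ ≤ (star φ ⬝ᵥ h.mulVec φ).re
  linarith

/-- A positive semidefinite form without zeros on a subspace is bounded below by a positive multiple
of the squared norm there. -/
theorem exists_pos_mul_nsq_le_form {h : Matrix ι ι ℂ} (hh : h.PosSemidef)
    (W : Submodule ℂ (ι → ℂ)) (hW : ∀ φ ∈ W, h.mulVec φ = 0 → φ = 0) :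
    ∃ c : ℝ, 0 < c ∧ ∀ φ ∈ W, c * nsq φ ≤ form h φ := by
  have hcf : Continuous fun φ : ι → ℂ => form h φ := by
    unfold form
    simp only [dotProduct, Matrix.mulVec]
    fun_prop
  have hcn : Continuous fun φ : ι → ℂ => nsq φ := by
    simp only [nsq_eq_sum]
    fun_prop
  -- The form attains its minimum on the compact unit sphere of `W`, and a minimum of zero would
  -- give a unit vector of `W` in the kernel.
  have hcomp : IsCompact {φ : ι → ℂ | φ ∈ W ∧ nsq φ = 1} := by
    apply Metric.isCompact_of_isClosed_isBounded
    · exact W.closed_of_finiteDimensional.inter (isClosed_eq hcn continuous_const)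
    · refine (Metric.isBounded_closedBall (x := (0 : ι → ℂ)) (r := 1)).subset ?_
      rintro φ ⟨-, h1⟩
      rw [mem_closedBall_zero_iff, pi_norm_le_iff_of_nonneg zero_le_one]
      intro i
      rw [nsq_eq_sum] at h1
      have := Finset.single_le_sum (f := fun i => ‖φ i‖ ^ 2) (fun _ _ => by positivity)
        (Finset.mem_univ i)
      rw [h1] at this
      nlinarith [norm_nonneg (φ i)]
  have hne0 : ∀ φ : ι → ℂ, nsq φ ≠ 0 → φ ≠ 0 := by
    rintro φ h1 rfl
    exact h1 (by simp [nsq])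
  obtain hem | hne := Set.eq_empty_or_nonempty {φ : ι → ℂ | φ ∈ W ∧ nsq φ = 1}
  · refine ⟨1, one_pos, fun φ hφ => ?_⟩
    by_cases h0 : nsq φ = 0
    · rw [h0, mul_zero]
      exact form_nonneg hh φ
    · exfalso
      have hp := nsq_pos (hne0 φ h0)
      have : ((Real.sqrt (nsq φ))⁻¹ : ℂ) • φ ∈ ({φ : ι → ℂ | φ ∈ W ∧ nsq φ = 1} : Set _) := by
        refine ⟨W.smul_mem _ hφ, ?_⟩
        rw [← Complex.ofReal_inv, nsq_smul, inv_pow, Real.sq_sqrt hp.le, inv_mul_cancel₀ h0]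
      rw [hem] at this
      exact this
  · obtain ⟨φ₀, ⟨hφ₀, hn₀⟩, hmin⟩ := hcomp.exists_isMinOn hne hcf.continuousOn
    refine ⟨form h φ₀, lt_of_le_of_ne (form_nonneg hh φ₀) fun h0 => ?_, fun φ hφ => ?_⟩
    · exact hne0 φ₀ (by rw [hn₀]; exact one_ne_zero) (hW φ₀ hφ₀ (mulVec_eq_zero_of_form hh h0.symm))
    · by_cases h0 : nsq φ = 0
      · rw [h0, mul_zero]
        exact form_nonneg hh φ
      · have hp := nsq_pos (hne0 φ h0)
        have hmem : ((Real.sqrt (nsq φ))⁻¹ : ℂ) • φ ∈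
            ({φ : ι → ℂ | φ ∈ W ∧ nsq φ = 1} : Set _) := by
          refine ⟨W.smul_mem _ hφ, ?_⟩
          rw [← Complex.ofReal_inv, nsq_smul, inv_pow, Real.sq_sqrt hp.le, inv_mul_cancel₀ h0]
        have h2 : form h φ₀ ≤ form h (((Real.sqrt (nsq φ))⁻¹ : ℂ) • φ) := hmin hmem
        rw [← Complex.ofReal_inv, form_smul, inv_pow, Real.sq_sqrt hp.le] at h2
        rwa [inv_mul_eq_div, le_div_iff₀ hp] at h2

/-- Every subspace is the kernel of a positive semidefinite matrix. -/
theorem exists_posSemidef_mulVec_eq_zero_iff [DecidableEq ι] (W : Submodule ℂ (ι → ℂ)) :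
    ∃ h : Matrix ι ι ℂ, h.PosSemidef ∧ ∀ φ, h.mulVec φ = 0 ↔ φ ∈ W := by
  obtain ⟨V, hV⟩ := W.exists_isCompl
  -- Any projection along `W` will do, orthogonal or not, because `L† L` has the same kernel as `L`.
  let L : (ι → ℂ) →ₗ[ℂ] (ι → ℂ) := V.subtype ∘ₗ Submodule.projectionOnto V W hV.symm
  refine ⟨(LinearMap.toMatrix' L).conjTranspose * LinearMap.toMatrix' L,
    Matrix.posSemidef_conjTranspose_mul_self _, fun φ => ?_⟩
  rw [Matrix.conjTranspose_mul_self_mulVec_eq_zero, ← Matrix.toLin'_apply, Matrix.toLin'_toMatrix']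
  change ((Submodule.projectionOnto V W hV.symm φ : V) : ι → ℂ) = 0 ↔ _
  rw [Submodule.coe_eq_zero, Submodule.projectionOnto_apply_eq_zero_iff]

/-- The rank-one operator `|g⟩⟨g|`. -/
noncomputable def proj (g : ι → ℂ) : Matrix ι ι ℂ := Matrix.vecMulVec g (star g)

theorem form_sub_smul_proj (h : Matrix ι ι ℂ) (c : ℝ) (g φ : ι → ℂ) :
    form (h - (c : ℂ) • proj g) φ = form h φ - c * ‖star g ⬝ᵥ φ‖ ^ 2 := by
  have h1 : (proj g).mulVec φ = (star g ⬝ᵥ φ) • g := by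
    rw [proj, Matrix.vecMulVec_mulVec]
    funext i
    simp [mul_comm]
  have h2 : star φ ⬝ᵥ g = star (star g ⬝ᵥ φ) := by
    rw [Matrix.star_dotProduct]
  rw [form, Matrix.sub_mulVec, Matrix.smul_mulVec, h1, dotProduct_sub, dotProduct_smul,
    dotProduct_smul, h2, Complex.sub_re, smul_eq_mul, smul_eq_mul, Complex.re_ofReal_mul,
    Complex.star_def, Complex.mul_conj, Complex.ofReal_re, Complex.normSq_eq_norm_sq]
  rfl

end forms

theorem isHermitian_sub_smul_proj {ι : Type*} {h : Matrix ι ι ℂ} (hh : h.IsHermitian) (c : ℝ) (g : ι → ℂ) :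
    (h - (c : ℂ) • proj g).IsHermitian := by
  refine hh.sub ?_
  rw [Matrix.IsHermitian, Matrix.conjTranspose_smul, proj, Matrix.conjTranspose_vecMulVec, star_star]
  simp

/-! ### Infinite matrix product states as sums of window vectors. -/

section imps

variable {b d k : ℕ}

theorem sum_conjTranspose_word {A : Fin d → Matrix (Fin b) (Fin b) ℂ}
    {σ : Matrix (Fin b) (Fin b) ℂ} (h : ∑ i, (A i).conjTranspose * σ * A i = σ) (m : ℕ) :
    ∑ u : Fin m → Fin d, (word A u).conjTranspose * σ * word A u = σ := by
  induction m with
  | zero => simp [word]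
  | succ m ih =>
    rw [sum_fin_cons, Finset.sum_comm]
    conv_rhs => rw [← ih]
    refine Finset.sum_congr rfl fun u _ => ?_
    have hw : ∀ a, word A (Fin.cons a u : Fin (m + 1) → Fin d) = A a * word A u := by
      intro a
      simp [word, List.ofFn_succ]
    simp only [hw, Matrix.conjTranspose_mul]
    nth_rewrite 2 [← h]
    rw [Finset.mul_sum, Finset.sum_mul]
    simp only [mul_assoc]

theorem trace_reducedDensity {A : Fin d → Matrix (Fin b) (Fin b) ℂ}
    {σ : Matrix (Fin b) (Fin b) ℂ} (h : IsIMPS A σ) : (reducedDensity k A σ).trace = 1 := by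
  rw [← h.trace_eq_one]
  conv_rhs => rw [← sum_conjTranspose_word h.stationary k]
  rw [Matrix.trace_sum]
  rfl

/-- The energy of an infinite matrix product state is a sum of values of the quadratic form. -/
theorem trace_reducedDensity_mul (A : Fin d → Matrix (Fin b) (Fin b) ℂ)
    (T : Matrix (Fin b) (Fin b) ℂ) (h : Matrix (Fin k → Fin d) (Fin k → Fin d) ℂ) :
    (reducedDensity k A (T.conjTranspose * T) * h).trace.re =
      ∑ a, ∑ c, form h (fun u => (T * word A u) a c) := by
  have hρ : ∀ i j, reducedDensity k A (T.conjTranspose * T) i j =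
      ∑ a, ∑ c, star ((T * word A j) a c) * (T * word A i) a c := by
    intro i j
    rw [reducedDensity, Matrix.of_apply, ← mul_assoc, ← Matrix.conjTranspose_mul, mul_assoc,
      Finset.sum_comm]
    rfl
  rw [Matrix.trace]
  simp only [Matrix.diag_apply, Matrix.mul_apply (M := reducedDensity k A _), hρ, form, dotProduct,
    Matrix.mulVec, Pi.star_apply, Finset.mul_sum, Finset.sum_mul, ← Complex.re_sum]
  congr 1
  rw [Finset.sum_comm]
  rw [Finset.sum_congr rfl fun j _ => Finset.sum_comm]
  rw [Finset.sum_comm]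
  refine Finset.sum_congr rfl fun a _ => ?_
  rw [Finset.sum_congr rfl fun j _ => Finset.sum_comm]
  rw [Finset.sum_comm]
  refine Finset.sum_congr rfl fun c _ => Finset.sum_congr rfl fun j _ =>
    Finset.sum_congr rfl fun i _ => ?_
  ring

theorem sum_nsq_of_isIMPS {A : Fin d → Matrix (Fin b) (Fin b) ℂ}
    {T : Matrix (Fin b) (Fin b) ℂ} (h : IsIMPS A (T.conjTranspose * T)) :
    ∑ a, ∑ c, nsq (fun u : Fin k → Fin d => (T * word A u) a c) = 1 := by
  have := trace_reducedDensity_mul (k := k) A T 1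
  rw [mul_one, trace_reducedDensity h, Complex.one_re] at this
  rw [this]
  simp only [form, Matrix.one_mulVec, nsq]

/-- The vectors in the decomposition of an iMPS energy are of the same kind as the windows of a
finite chain, so one local analysis serves both. -/
theorem isUncut_mul_word (A : Fin d → Matrix (Fin b) (Fin b) ℂ)
    (T : Matrix (Fin b) (Fin b) ℂ) (a c : Fin b) :
    IsUncut A (fun u : Fin k → Fin d => (T * word A u) a c) := by
  refine ⟨Matrix.single c a 1 * T, funext fun u => ?_⟩
  rw [word_eq_listWord, mul_assoc, Matrix.trace_single_mul, one_smul]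

theorem exists_conjTranspose_mul_self {σ : Matrix (Fin b) (Fin b) ℂ} (h : σ.PosSemidef) :
    ∃ T : Matrix (Fin b) (Fin b) ℂ, σ = T.conjTranspose * T := by
  open scoped MatrixOrder in
  exact CStarAlgebra.nonneg_iff_eq_star_mul_self.1 h.nonneg

end imps

/-- A plateau of the least energies at the value zero. -/
theorem energyChain_of_plateau {S : ℕ → Set ℝ} {D' D : ℕ} (hD' : 1 < D') (hD : D' < D)
    (hne : ∀ b, 1 ≤ b → (S b).Nonempty) (hbdd : ∀ b, BddBelow (S b))
    (hnonneg : ∀ b, b ≤ D → ∀ E ∈ S b, 0 ≤ E)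
    (hpos : ∃ c : ℝ, 0 < c ∧ ∀ E ∈ S (D' - 1), c ≤ E)
    (hzero : ∀ b, D' ≤ b → b ≤ D → (0 : ℝ) ∈ S b)
    (hneg : ∃ E ∈ S (D + 1), E < 0) : EnergyChain S D' D := by
  have hz : ∀ b, D' ≤ b → b ≤ D → sInf (S b) = 0 := fun b h1 h2 =>
    IsLeast.csInf_eq ⟨hzero b h1 h2, fun E hE => hnonneg b h2 E hE⟩
  refine ⟨fun b => sInf (S b), fun b hb => ⟨hne b hb, isGLB_csInf (hne b hb) (hbdd b)⟩, ?_,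
    fun b h1 h2 => ?_, ?_⟩
  · obtain ⟨c, hc, hcE⟩ := hpos
    simp only [hz D' le_rfl hD.le]
    exact lt_of_lt_of_le hc (le_csInf (hne _ (by omega)) hcE)
  · simp only [hz b h1 h2, hz D' le_rfl hD.le]
  · obtain ⟨E, hE, hE0⟩ := hneg
    simp only [hz D hD.le le_rfl]
    exact lt_of_le_of_lt (csInf_le (hbdd _) hE) hE0

/-! ### Abstract properties required of the two explicit families. -/

section families

/-- Matrices of size `p` and words in them such that only one ordering of the words has a nonzero
product, and such that every nonzero product of `k` matrices is a multiple of a product that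
contains this ordering. -/
structure IsRigidFamily {d p : ℕ} (k : ℕ) (A : Fin d → Matrix (Fin p) (Fin p) ℂ)
    (X : Fin (2 * (p - 1)) → List (Fin d)) : Prop where
  shuffle_eq_zero : ∀ π, π ≠ 1 → listWord A (shuffle X π) = 0
  cover : ∀ L : List (Fin d), L.length = k → listWord A L = 0 ∨
    ∃ (y z : List (Fin d)) (c : ℂ), (y ++ shuffle X 1 ++ z).length = k ∧
      listWord A L = c • listWord A (y ++ shuffle X 1 ++ z)
  imps : ∃ (s : ℂ) (σ : Matrix (Fin p) (Fin p) ℂ), IsIMPS (s • A) σ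

/-- Matrices of size `D + 1`, words in them with a unique ordering of nonzero product and a word `R`
that turns this product into a diagonal matrix unit. -/
structure IsDetectedFamily {d D : ℕ} (k : ℕ) (A : Fin d → Matrix (Fin (D + 1)) (Fin (D + 1)) ℂ)
    (X : Fin (2 * D) → List (Fin d)) (R : List (Fin d)) : Prop where
  length_eq : k = 2 * ((shuffle X 1).length + R.length)
  shuffle_eq_zero : ∀ π, π ≠ 1 → listWord A (shuffle X π) = 0
  shuffle_one : listWord A (shuffle X 1 ++ R) = Matrix.single 0 0 1
  imps : ∃ (s : ℂ) (σ : Matrix (Fin (D + 1)) (Fin (D + 1)) ℂ), s ≠ 0 ∧ IsIMPS (s • A) σ ∧ σ 0 0 ≠ 0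

theorem listWord_smul {b d : ℕ} (s : ℂ) (A : Fin d → Matrix (Fin b) (Fin b) ℂ)
    (L : List (Fin d)) : listWord (s • A) L = s ^ L.length • listWord A L := by
  induction L with
  | nil => simp
  | cons a L ih =>
    rw [listWord_cons, listWord_cons, ih, Pi.smul_apply, smul_mul_smul_comm, List.length_cons,
      pow_succ']

theorem IsUncut.of_smul {b d k : ℕ} {s : ℂ} {A : Fin d → Matrix (Fin b) (Fin b) ℂ}
    {φ : (Fin k → Fin d) → ℂ} (h : IsUncut (s • A) φ) : IsUncut A φ := by
  obtain ⟨C, rfl⟩ := h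
  refine ⟨s ^ k • C, funext fun u => ?_⟩
  rw [listWord_smul, List.length_ofFn, Matrix.mul_smul, Matrix.smul_mul]

/-- The space of all vectors that arise from a matrix product state without insertion. -/
def uncutSpace {b d : ℕ} (k : ℕ) (A : Fin d → Matrix (Fin b) (Fin b) ℂ) :
    Submodule ℂ ((Fin k → Fin d) → ℂ) where
  carrier := {φ | IsUncut A φ}
  add_mem' := by
    rintro _ _ ⟨C, rfl⟩ ⟨C', rfl⟩
    exact ⟨C + C', by funext u; simp [add_mul]⟩
  zero_mem' := ⟨0, by funext u; simp⟩
  smul_mem' := by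
    rintro c _ ⟨C, rfl⟩
    exact ⟨c • C, by funext u; simp⟩

/-- The vectors that are annihilated by the standard polynomial in the words `X` in all
positions. -/
def standardKernel {d N : ℕ} (k : ℕ) (X : Fin N → List (Fin d)) :
    Submodule ℂ ((Fin k → Fin d) → ℂ) where
  carrier := {φ | ∀ y z : List (Fin d), (y ++ shuffle X 1 ++ z).length = k →
    ∑ π, csign π * (listVec k (y ++ shuffle X π ++ z) ⬝ᵥ φ) = 0}
  add_mem' := by
    intro φ φ' h h' y z hyz
    simp only [dotProduct_add, mul_add, Finset.sum_add_distrib, h y z hyz, h' y z hyz, add_zero]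
  zero_mem' := by
    intro y z hyz
    simp
  smul_mem' := by
    intro c φ h y z hyz
    simp only [dotProduct_smul, smul_eq_mul, mul_left_comm _ c]
    rw [← Finset.mul_sum, h y z hyz, mul_zero]

theorem length_append_shuffle {d N : ℕ} (X : Fin N → List (Fin d)) (π : Equiv.Perm (Fin N))
    (y z : List (Fin d)) :
    (y ++ shuffle X π ++ z).length = (y ++ shuffle X 1 ++ z).length := by
  simp only [List.length_append, length_shuffle]

/-- The identity of Amitsur–Levitzki persists when fixed words `y` and `z` surround it. -/
theorem IsUncut.mem_standardKernel {b d k N : ℕ} (hN : 2 * b ≤ N)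
    {A : Fin d → Matrix (Fin b) (Fin b) ℂ} {φ : (Fin k → Fin d) → ℂ} (h : IsUncut A φ)
    (X : Fin N → List (Fin d)) : φ ∈ standardKernel k X := by
  obtain ⟨C, rfl⟩ := h
  intro y z hyz
  rw [← sum_csign_mul_trace hN A X (C * listWord A y) (listWord A z)]
  refine Finset.sum_congr rfl fun π _ => ?_
  rw [listVec_dotProduct (by rw [length_append_shuffle, hyz])
    fun l => (C * listWord A l).trace]
  simp only [listWord_append, mul_assoc]

/-- On a window vector of `A` each standard relation has a single surviving term, so the coefficient
of every word `y X z` vanishes. By `cover`, every other coefficient is zero or a multiple of one of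
these. The lemma separates `A` from all families of bond dimension `p - 1`. -/
theorem IsRigidFamily.eq_zero {d p k : ℕ} {A : Fin d → Matrix (Fin p) (Fin p) ℂ}
    {X : Fin (2 * (p - 1)) → List (Fin d)} (hA : IsRigidFamily k A X)
    {φ : (Fin k → Fin d) → ℂ} (h : IsUncut A φ) (h' : φ ∈ standardKernel k X) : φ = 0 := by
  obtain ⟨C, rfl⟩ := h
  have key : ∀ y z : List (Fin d), (y ++ shuffle X 1 ++ z).length = k →
      (C * listWord A (y ++ shuffle X 1 ++ z)).trace = 0 := by
    intro y z hyz
    have h1 := h' y z hyz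
    rw [Finset.sum_eq_single 1] at h1
    · rw [listVec_dotProduct hyz fun l => (C * listWord A l).trace] at h1
      simpa [csign] using h1
    · intro π _ hπ
      rw [listVec_dotProduct (by rw [length_append_shuffle, hyz])
        fun l => (C * listWord A l).trace]
      simp [hA.shuffle_eq_zero π hπ]
    · simp
  funext u
  rcases hA.cover (List.ofFn u) (List.length_ofFn) with h0 | ⟨y, z, c, hl, hc⟩
  · simp [h0]
  · simp only [hc, Matrix.mul_smul, Matrix.trace_smul, key y z hl, smul_zero, Pi.zero_apply]

/-- Only the identity orderings contribute, and their product is `E₀₀ E₀₀ = E₀₀`. This is the source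
of the overlap of `B` with `g`. -/
theorem IsDetectedFamily.apply_eq {d D k : ℕ} {A : Fin d → Matrix (Fin (D + 1)) (Fin (D + 1)) ℂ}
    {X : Fin (2 * D) → List (Fin d)} {R : List (Fin d)} (hA : IsDetectedFamily k A X R)
    (F : Matrix (Fin (D + 1)) (Fin (D + 1)) ℂ → ℂ) (hF : F 0 = 0) :
    star (doubleStandard k X R) ⬝ᵥ (fun u => F (listWord A (List.ofFn u))) =
      F (Matrix.single 0 0 1) := by
  rw [star_doubleStandard_dotProduct hA.length_eq fun l => F (listWord A l)]
  rw [Finset.sum_eq_single 1, Finset.sum_eq_single 1]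
  · rw [listWord_append, hA.shuffle_one]
    simp [csign]
  · intro π _ hπ
    simp [hA.shuffle_eq_zero π hπ, hF]
  · simp
  · intro π _ hπ
    refine Finset.sum_eq_zero fun π' _ => ?_
    simp [hA.shuffle_eq_zero π hπ, hF]
  · simp

end families

/-! ### Embedding into larger bond dimensions. -/

section padding

variable {d p r : ℕ}

/-- The block diagonal sum of two families of matrices. -/
noncomputable def blockSum (A : Fin d → Matrix (Fin p) (Fin p) ℂ)
    (A' : Fin d → Matrix (Fin r) (Fin r) ℂ) : Fin d → Matrix (Fin (p + r)) (Fin (p + r)) ℂ :=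
  fun i => Matrix.reindexAlgEquiv ℂ ℂ finSumFinEquiv (Matrix.fromBlocks (A i) 0 0 (A' i))

theorem listWord_blockSum (A : Fin d → Matrix (Fin p) (Fin p) ℂ)
    (A' : Fin d → Matrix (Fin r) (Fin r) ℂ) (L : List (Fin d)) :
    listWord (blockSum A A') L = Matrix.reindexAlgEquiv ℂ ℂ finSumFinEquiv
      (Matrix.fromBlocks (listWord A L) 0 0 (listWord A' L)) := by
  induction L with
  | nil =>
    simp only [listWord_nil, Matrix.fromBlocks_one, map_one]
  | cons a L ih =>
    rw [listWord_cons, ih, blockSum, ← map_mul, Matrix.fromBlocks_multiply]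
    simp

theorem trace_reindex_fromBlocks (M : Matrix (Fin p) (Fin p) ℂ) (M' : Matrix (Fin r) (Fin r) ℂ) :
    (Matrix.reindexAlgEquiv ℂ ℂ finSumFinEquiv (Matrix.fromBlocks M 0 0 M')).trace =
      M.trace + M'.trace := by
  refine (Equiv.sum_comp finSumFinEquiv.symm fun i => Matrix.fromBlocks M 0 0 M' i i).trans ?_
  rw [Fintype.sum_sum_type]
  rfl

theorem conjTranspose_reindex_fromBlocks (M : Matrix (Fin p) (Fin p) ℂ)
    (M' : Matrix (Fin r) (Fin r) ℂ) :
    (Matrix.reindexAlgEquiv ℂ ℂ finSumFinEquiv (Matrix.fromBlocks M 0 0 M')).conjTranspose =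
      Matrix.reindexAlgEquiv ℂ ℂ finSumFinEquiv
        (Matrix.fromBlocks M.conjTranspose 0 0 M'.conjTranspose) := by
  rw [Matrix.coe_reindexAlgEquiv, Matrix.conjTranspose_reindex, Matrix.fromBlocks_conjTranspose]
  simp

theorem exists_mps_eq_of_le {b n : ℕ} (hn : 0 < n) (hb : p ≤ b)
    (A : Fin d → Matrix (Fin p) (Fin p) ℂ) :
    ∃ B : Fin d → Matrix (Fin b) (Fin b) ℂ, mps n 1 B = mps n 1 A := by
  obtain ⟨r, rfl⟩ := Nat.exists_eq_add_of_le hb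
  refine ⟨blockSum A 0, funext fun u => ?_⟩
  -- Positivity of `n` matters: on the empty word the zero block would contribute the trace of an
  -- identity matrix.
  obtain ⟨m, rfl⟩ := Nat.exists_eq_succ_of_ne_zero hn.ne'
  rw [mps, mps, one_mul, one_mul, word_eq_listWord, word_eq_listWord, listWord_blockSum,
    trace_reindex_fromBlocks, List.ofFn_succ, listWord_cons (0 : Fin d → Matrix (Fin r) (Fin r) ℂ)]
  simp

theorem exists_isIMPS_of_le {b k : ℕ} (hd : 0 < d) (hb : p ≤ b)
    {A : Fin d → Matrix (Fin p) (Fin p) ℂ} {σ : Matrix (Fin p) (Fin p) ℂ} (h : IsIMPS A σ) :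
    ∃ (B : Fin d → Matrix (Fin b) (Fin b) ℂ) (τ : Matrix (Fin b) (Fin b) ℂ),
      IsIMPS B τ ∧ reducedDensity k B τ = reducedDensity k A σ := by
  obtain ⟨r, rfl⟩ := Nat.exists_eq_add_of_le hb
  -- A zero block would violate `∑ A_i A_i† = 1`. The added block is therefore isometric, and it
  -- stays invisible because the padded `σ` vanishes on it.
  let A' : Fin d → Matrix (Fin r) (Fin r) ℂ := fun i => if i = ⟨0, hd⟩ then 1 else 0
  let τ := Matrix.reindexAlgEquiv ℂ ℂ (finSumFinEquiv (m := p) (n := r))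
    (Matrix.fromBlocks σ 0 0 0)
  refine ⟨blockSum A A', τ, ⟨?_, ?_, ?_, ?_⟩, ?_⟩
  · have h1 : ∑ i, A' i * (A' i).conjTranspose = 1 := by
      rw [Finset.sum_eq_single ⟨0, hd⟩]
      · simp [A']
      · intro i _ hi
        simp [A', hi]
      · simp
    have h2 : ∀ i, blockSum A A' i * (blockSum A A' i).conjTranspose =
        Matrix.reindexAlgEquiv ℂ ℂ finSumFinEquiv (Matrix.fromBlocks (A i * (A i).conjTranspose) 0 0
          (A' i * (A' i).conjTranspose)) := by
      intro i
      rw [blockSum, conjTranspose_reindex_fromBlocks, ← map_mul, Matrix.fromBlocks_multiply]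
      simp
    have h3 : ∀ (s : Finset (Fin d)) (f : Fin d → Matrix (Fin p) (Fin p) ℂ)
        (g : Fin d → Matrix (Fin r) (Fin r) ℂ), ∑ i ∈ s, Matrix.fromBlocks (f i) 0 0 (g i) =
          Matrix.fromBlocks (∑ i ∈ s, f i) 0 0 (∑ i ∈ s, g i) := by
      intro s f g
      induction s using Finset.cons_induction with
      | empty => simp
      | cons a s ha ih => rw [Finset.sum_cons, ih, Finset.sum_cons, Finset.sum_cons,
          Matrix.fromBlocks_add, add_zero, add_zero]
    simp only [h2]
    rw [← map_sum, h3, h.isometric, h1, Matrix.fromBlocks_one, map_one]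
  · obtain ⟨T, hT⟩ := exists_conjTranspose_mul_self h.posSemidef
    have : τ = (Matrix.reindexAlgEquiv ℂ ℂ (finSumFinEquiv (m := p) (n := r))
        (Matrix.fromBlocks T 0 0 0)).conjTranspose *
        Matrix.reindexAlgEquiv ℂ ℂ (finSumFinEquiv (m := p) (n := r))
        (Matrix.fromBlocks T 0 0 0) := by
      rw [conjTranspose_reindex_fromBlocks, ← map_mul, Matrix.fromBlocks_multiply]
      simp [τ, hT]
    rw [this]
    exact Matrix.posSemidef_conjTranspose_mul_self _
  · rw [trace_reindex_fromBlocks, h.trace_eq_one, Matrix.trace_zero, add_zero]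
  · have h2 : ∀ i, (blockSum A A' i).conjTranspose * τ * blockSum A A' i =
        Matrix.reindexAlgEquiv ℂ ℂ finSumFinEquiv
          (Matrix.fromBlocks ((A i).conjTranspose * σ * A i) 0 0 0) := by
      intro i
      rw [blockSum, conjTranspose_reindex_fromBlocks, ← map_mul, ← map_mul,
        Matrix.fromBlocks_multiply, Matrix.fromBlocks_multiply]
      simp
    have h3 : ∀ (s : Finset (Fin d)) (f : Fin d → Matrix (Fin p) (Fin p) ℂ),
        ∑ i ∈ s, Matrix.fromBlocks (f i) 0 0 (0 : Matrix (Fin r) (Fin r) ℂ) =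
          Matrix.fromBlocks (∑ i ∈ s, f i) 0 0 0 := by
      intro s f
      induction s using Finset.cons_induction with
      | empty => simp
      | cons a s ha ih => rw [Finset.sum_cons, ih, Finset.sum_cons,
          Matrix.fromBlocks_add, add_zero, add_zero, add_zero]
    simp only [h2]
    rw [← map_sum, h3, h.stationary]
  · ext i j
    rw [reducedDensity, reducedDensity, Matrix.of_apply, Matrix.of_apply, word_eq_listWord,
      word_eq_listWord, word_eq_listWord, word_eq_listWord, listWord_blockSum, listWord_blockSum,
      conjTranspose_reindex_fromBlocks, ← map_mul, ← map_mul, Matrix.fromBlocks_multiply,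
      Matrix.fromBlocks_multiply]
    simp only [Matrix.mul_zero, Matrix.zero_mul, add_zero]
    rw [trace_reindex_fromBlocks, Matrix.trace_zero, add_zero]

end padding

/-! ### Nonemptiness and lower bounds of the energy sets. -/

section energies

variable {d n k : ℕ}

theorem card_mul_form_chainHamiltonian (hk : k ≤ n)
    (h : Matrix (Fin k → Fin d) (Fin k → Fin d) ℂ) (ψ : (Fin n → Fin d) → ℂ) :
    (Fintype.card (Fin k → Fin d) : ℝ) * form (chainHamiltonian n h) ψ =
      ∑ j, ∑ x, form h (slice k j x ψ) := by
  rw [form_chainHamiltonian, Finset.mul_sum]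
  exact Finset.sum_congr rfl fun j _ => card_mul_form_localOp hk j h ψ

theorem average_eq (H : Matrix (Fin n → Fin d) (Fin n → Fin d) ℂ) (ψ : (Fin n → Fin d) → ℂ) :
    average H ψ = form H ψ / nsq ψ := rfl

theorem tiMpsEnergies_subset (H : Matrix (Fin n → Fin d) (Fin n → Fin d) ℂ) (b : ℕ) :
    tiMpsEnergies H b ⊆ mpsEnergies H b := by
  rintro E ⟨A, h, rfl⟩
  exact ⟨1, A, h, rfl⟩

theorem bddBelow_mpsEnergies (H : Matrix (Fin n → Fin d) (Fin n → Fin d) ℂ) (b : ℕ) :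
    BddBelow (mpsEnergies H b) := by
  obtain ⟨C, hC⟩ := form_lower_bound H
  refine ⟨-C, ?_⟩
  rintro E ⟨ω, A, h, rfl⟩
  rw [average_eq, le_div_iff₀ (nsq_pos h)]
  exact hC _

theorem tiMpsEnergies_nonempty (hd : 0 < d) (H : Matrix (Fin n → Fin d) (Fin n → Fin d) ℂ) {b : ℕ}
    (hb : 1 ≤ b) : (tiMpsEnergies H b).Nonempty := by
  refine ⟨_, fun _ => 1, ?_, rfl⟩
  intro h0
  have := congrFun h0 fun _ => ⟨0, hd⟩
  simp only [mps, word, List.ofFn_const, List.prod_replicate, one_pow, one_mul, Matrix.trace_one,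
    Fintype.card_fin, Pi.zero_apply, Nat.cast_eq_zero] at this
  omega

theorem bddBelow_impsEnergies (h : Matrix (Fin k → Fin d) (Fin k → Fin d) ℂ) (b : ℕ) :
    BddBelow (impsEnergies h b) := by
  obtain ⟨C, hC⟩ := form_lower_bound h
  refine ⟨-C, ?_⟩
  rintro E ⟨A, σ, hA, rfl⟩
  obtain ⟨T, rfl⟩ := exists_conjTranspose_mul_self hA.posSemidef
  rw [trace_reducedDensity_mul, ← mul_one (-C), ← sum_nsq_of_isIMPS (k := k) hA, Finset.mul_sum]
  refine Finset.sum_le_sum fun a _ => ?_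
  rw [Finset.mul_sum]
  exact Finset.sum_le_sum fun c _ => hC _

theorem impsEnergies_nonempty (hd : 0 < d) (h : Matrix (Fin k → Fin d) (Fin k → Fin d) ℂ) {b : ℕ}
    (hb : 1 ≤ b) : (impsEnergies h b).Nonempty := by
  refine ⟨_, fun i => if i = ⟨0, hd⟩ then 1 else 0, Matrix.single ⟨0, hb⟩ ⟨0, hb⟩ 1,
    ⟨?_, ?_, ?_, ?_⟩, rfl⟩
  · rw [Finset.sum_eq_single ⟨0, hd⟩]
    · simp
    · intro i _ hi
      simp [hi]
    · simp
  · have : (Matrix.single ⟨0, hb⟩ ⟨0, hb⟩ 1 : Matrix (Fin b) (Fin b) ℂ) =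
        (Matrix.single ⟨0, hb⟩ ⟨0, hb⟩ 1).conjTranspose * Matrix.single ⟨0, hb⟩ ⟨0, hb⟩ 1 := by
      simp
    rw [this]
    exact Matrix.posSemidef_conjTranspose_mul_self _
  · simp
  · rw [Finset.sum_eq_single ⟨0, hd⟩]
    · simp
    · intro i _ hi
      simp [hi]
    · simp

end energies

/-! ### The Hamiltonians with a plateau. -/

section plateau

variable {d k D D' : ℕ} {A : Fin d → Matrix (Fin D') (Fin D') ℂ}
  {X : Fin (2 * (D' - 1)) → List (Fin d)} {B : Fin d → Matrix (Fin (D + 1)) (Fin (D + 1)) ℂ}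
  {Y : Fin (2 * D) → List (Fin d)} {R : List (Fin d)}

/-- Up to bond dimension `D` the perturbation is invisible, because `g` is orthogonal to all cut
vectors. -/
theorem form_eq_of_isCut (hB : IsDetectedFamily k B Y R) {b : ℕ} (hb : b ≤ D)
    {M : Fin d → Matrix (Fin b) (Fin b) ℂ} {φ : (Fin k → Fin d) → ℂ} (hφ : IsCut M φ)
    (h₀ : Matrix (Fin k → Fin d) (Fin k → Fin d) ℂ) (ε : ℝ) :
    form (h₀ - (ε : ℂ) • proj (doubleStandard k Y R)) φ = form h₀ φ := by
  rw [form_sub_smul_proj, star_doubleStandard_dotProduct_isCut (by omega) hB.length_eq hφ]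
  simp

/-- The energies of infinite matrix product states have a plateau. -/
theorem exists_imps_energyChain (hd : 0 < d) (hD' : 1 < D') (hD : D' < D)
    (hA : IsRigidFamily k A X) (hB : IsDetectedFamily k B Y R) :
    ∃ h : Matrix (Fin k → Fin d) (Fin k → Fin d) ℂ,
      h.IsHermitian ∧ EnergyChain (impsEnergies h) D' D := by
  obtain ⟨h₀, hh₀, hker⟩ := exists_posSemidef_mulVec_eq_zero_iff (uncutSpace k A)
  obtain ⟨c, hc, hcoer⟩ := exists_pos_mul_nsq_le_form hh₀ (standardKernel k X)
    fun φ h1 h2 => hA.eq_zero ((hker φ).1 h2) h1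
  obtain ⟨s, σ, hs, hσ, hσ0⟩ := hB.imps
  obtain ⟨T, rfl⟩ := exists_conjTranspose_mul_self hσ.posSemidef
  set g := doubleStandard k Y R with hg
  set E₀ := ∑ a, ∑ c, form h₀ (fun u => (T * word (s • B) u) a c) with hE₀
  set V := ∑ a, ∑ c, ‖star g ⬝ᵥ (fun u => (T * word (s • B) u) a c)‖ ^ 2 with hV
  have hVpos : 0 < V := by
    -- The overlap of `g` with column `0` of `T` times the word is a multiple of `T a 0`. These
    -- entries are not all zero, since `σ 0 0` is the squared norm of column `0` of `T`.
    have hval : ∀ a, star g ⬝ᵥ (fun u => (T * word (s • B) u) a 0) = s ^ k * T a 0 := by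
      intro a
      have h1 := hB.apply_eq (fun M => (T * (s ^ k • M)) a 0) (by simp)
      simp only [Matrix.mul_smul, Matrix.smul_apply, smul_eq_mul] at h1
      rw [Matrix.mul_single_apply_same, mul_one] at h1
      rw [← h1]
      congr 1
      funext u
      rw [word_eq_listWord, listWord_smul, List.length_ofFn, Matrix.mul_smul, Matrix.smul_apply,
        smul_eq_mul]
    obtain ⟨a, ha⟩ : ∃ a, T a 0 ≠ 0 := by
      by_contra! hne
      apply hσ0
      simp [Matrix.mul_apply, hne]
    refine Finset.sum_pos' (fun _ _ => Finset.sum_nonneg fun _ _ => by positivity)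
      ⟨a, Finset.mem_univ _, Finset.sum_pos' (fun _ _ => by positivity) ⟨0, Finset.mem_univ _, ?_⟩⟩
    rw [hval]
    have := norm_pos_iff.2 (mul_ne_zero (pow_ne_zero k hs) ha)
    positivity
  -- The coefficient `(E₀ + 1) / V` makes the energy of `B` equal to `E₀ - (E₀ + 1) = -1`.
  refine ⟨h₀ - (((E₀ + 1) / V : ℝ) : ℂ) • proj g, isHermitian_sub_smul_proj hh₀.1 _ _, ?_⟩
  refine energyChain_of_plateau hD' hD (fun b hb => impsEnergies_nonempty hd _ hb)
    (fun b => bddBelow_impsEnergies _ b) ?_ ⟨c, hc, ?_⟩ ?_ ?_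
  · rintro b hb E ⟨M, τ, hM, rfl⟩
    obtain ⟨T', rfl⟩ := exists_conjTranspose_mul_self hM.posSemidef
    rw [trace_reducedDensity_mul]
    refine Finset.sum_nonneg fun a _ => Finset.sum_nonneg fun c _ => ?_
    rw [form_eq_of_isCut hB hb (isUncut_mul_word M T' a c).isCut]
    exact form_nonneg hh₀ _
  · rintro E ⟨M, τ, hM, rfl⟩
    obtain ⟨T', rfl⟩ := exists_conjTranspose_mul_self hM.posSemidef
    rw [trace_reducedDensity_mul, ← mul_one c, ← sum_nsq_of_isIMPS (k := k) hM, Finset.mul_sum]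
    refine Finset.sum_le_sum fun a _ => ?_
    rw [Finset.mul_sum]
    refine Finset.sum_le_sum fun e _ => ?_
    have hu := isUncut_mul_word (k := k) M T' a e
    rw [form_eq_of_isCut hB (by omega) hu.isCut]
    exact hcoer _ (hu.mem_standardKernel le_rfl X)
  · intro b hb1 hb2
    obtain ⟨t, τ, hτ⟩ := hA.imps
    obtain ⟨M, τ', hM, hρ⟩ := exists_isIMPS_of_le (k := k) hd hb1 hτ
    refine ⟨M, τ', hM, ?_⟩
    obtain ⟨T', rfl⟩ := exists_conjTranspose_mul_self hτ.posSemidef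
    rw [hρ, trace_reducedDensity_mul]
    symm
    refine Finset.sum_eq_zero fun a _ => Finset.sum_eq_zero fun e _ => ?_
    have hu := isUncut_mul_word (k := k) (t • A) T' a e
    rw [form_eq_of_isCut hB hD.le hu.isCut]
    exact form_eq_zero_of_mulVec ((hker _).2 hu.of_smul)
  · refine ⟨_, ⟨_, _, hσ, rfl⟩, ?_⟩
    rw [trace_reducedDensity_mul]
    simp only [form_sub_smul_proj, Finset.sum_sub_distrib, ← Finset.mul_sum]
    rw [← hE₀, ← hV, div_mul_cancel₀ _ hVpos.ne']
    linarith

/-- The energies of finite matrix product states have a plateau, both for arbitrary and for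
translation-invariant boundary conditions. -/
theorem exists_mps_energyChain {n : ℕ} (hd : 0 < d) (hk : k ≤ n) (hn : 0 < n) (hD' : 1 < D')
    (hD : D' < D) (hA : IsRigidFamily k A X) (hB : IsDetectedFamily k B Y R)
    (hAn : mps n 1 A ≠ 0) (hBn : ∃ L : List (Fin d), L.length = n - k ∧ listWord B L 0 0 ≠ 0) :
    ∃ H : Matrix (Fin n → Fin d) (Fin n → Fin d) ℂ,
      IsLocalHamiltonian k H ∧ IsTranslationInvariant H ∧
      EnergyChain (mpsEnergies H) D' D ∧ EnergyChain (tiMpsEnergies H) D' D := by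
  obtain ⟨h₀, hh₀, hker⟩ := exists_posSemidef_mulVec_eq_zero_iff (uncutSpace k A)
  obtain ⟨c, hc, hcoer⟩ := exists_pos_mul_nsq_le_form hh₀ (standardKernel k X)
    fun φ h1 h2 => hA.eq_zero ((hker φ).1 h2) h1
  have hcard : (0 : ℝ) < Fintype.card (Fin k → Fin d) := by
    have : Nonempty (Fin k → Fin d) := ⟨fun _ => ⟨0, hd⟩⟩
    exact_mod_cast Fintype.card_pos
  set g := doubleStandard k Y R with hg
  set ψ := mps n 1 B with hψ
  set E₀ := ∑ j : Fin n, ∑ x, form h₀ (slice k j x ψ) with hE₀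
  set V := ∑ j : Fin n, ∑ x, ‖star g ⬝ᵥ slice k j x ψ‖ ^ 2 with hV
  obtain ⟨j₀, x₀, hx₀⟩ : ∃ (j : Fin n) (x : Fin n → Fin d), star g ⬝ᵥ slice k j x ψ ≠ 0 := by
    obtain ⟨L, hL, hL0⟩ := hBn
    have hlen : (List.replicate k (⟨0, hd⟩ : Fin d) ++ L).length = n := by
      simp [hL, hk]
    obtain ⟨x, hx⟩ : ∃ x : Fin n → Fin d, List.ofFn x = List.replicate k ⟨0, hd⟩ ++ L := by
      have h1 : ∀ l : List (Fin d), l.length = n → ∃ x : Fin n → Fin d, List.ofFn x = l := by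
        rintro l rfl
        exact ⟨l.get, List.ofFn_get l⟩
      exact h1 _ hlen
    refine ⟨⟨0, hn⟩, x, ?_⟩
    -- In the window at the start of the chain `g` replaces the product by `E₀₀`, so the overlap is
    -- the `(0, 0)` entry of the word `L` on the other `n - k` sites.
    have h1 := hB.apply_eq (fun M => (M * listWord B L).trace) (by simp)
    have h2 : slice k (⟨0, hn⟩ : Fin n) x ψ =
        fun u => (listWord B (List.ofFn u) * listWord B L).trace := by
      funext u
      rw [slice, hψ, mps, one_mul, word_eq_listWord, ofFn_putAt_of_le _ _ _ (by simpa using hk), hx]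
      simp
    rw [h2, h1, Matrix.trace_single_mul]
    simpa using hL0
  have hVpos : 0 < V := by
    refine Finset.sum_pos' (fun _ _ => Finset.sum_nonneg fun _ _ => by positivity)
      ⟨j₀, Finset.mem_univ _, Finset.sum_pos' (fun _ _ => by positivity) ⟨x₀, Finset.mem_univ _, ?_⟩⟩
    have := norm_pos_iff.2 hx₀
    positivity
  have hψ0 : ψ ≠ 0 := by
    intro h0
    apply hx₀
    have : slice k j₀ x₀ ψ = 0 := by
      funext u
      simp [slice, h0]
    rw [this, dotProduct_zero]
  set h := h₀ - (((E₀ + 1) / V : ℝ) : ℂ) • proj g with hh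
  have hslice : ∀ {b : ℕ}, b ≤ D → ∀ (ω : Matrix (Fin b) (Fin b) ℂ)
      (M : Fin d → Matrix (Fin b) (Fin b) ℂ) (j : Fin n) (x : Fin n → Fin d),
      form h (slice k j x (mps n ω M)) = form h₀ (slice k j x (mps n ω M)) :=
    fun hb ω M j x => form_eq_of_isCut hB hb (isCut_slice hk M ω j x).1 _ _
  have hnonneg : ∀ b, b ≤ D → ∀ E ∈ mpsEnergies (chainHamiltonian n h) b, 0 ≤ E := by
    rintro b hb E ⟨ω, M, hM, rfl⟩
    rw [average_eq]
    refine div_nonneg ?_ (nsq_nonneg _)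
    refine nonneg_of_mul_nonneg_right ?_ hcard
    rw [card_mul_form_chainHamiltonian hk]
    refine Finset.sum_nonneg fun j _ => Finset.sum_nonneg fun x _ => ?_
    rw [hslice hb]
    exact form_nonneg hh₀ _
  have hpos : ∀ E ∈ mpsEnergies (chainHamiltonian n h) (D' - 1), c ≤ E := by
    rintro E ⟨ω, M, hM, rfl⟩
    rw [average_eq, le_div_iff₀ (nsq_pos hM)]
    refine le_of_mul_le_mul_left ?_ hcard
    rw [card_mul_form_chainHamiltonian hk, mul_left_comm, card_mul_nsq hk ⟨0, hn⟩, Finset.mul_sum]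
    -- One window is enough for the gap, the others being nonnegative. The window at site `0` does
    -- not wrap, so it is uncut even for arbitrary `ω`.
    refine le_trans ?_ (Finset.single_le_sum (f := fun j => ∑ x, form h (slice k j x (mps n ω M)))
      (fun j _ => Finset.sum_nonneg fun x _ => ?_) (Finset.mem_univ (⟨0, hn⟩ : Fin n)))
    · refine Finset.sum_le_sum fun x _ => ?_
      rw [hslice (by omega)]
      exact hcoer _ ((isUncut_slice_of_le M ω _ x (by simpa using hk)).mem_standardKernel le_rfl X)
    · rw [hslice (by omega)]
      exact form_nonneg hh₀ _
  have hzero : ∀ b, D' ≤ b → b ≤ D → (0 : ℝ) ∈ tiMpsEnergies (chainHamiltonian n h) b := by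
    intro b hb1 hb2
    obtain ⟨M, hM⟩ := exists_mps_eq_of_le hn hb1 A
    refine ⟨M, by rwa [hM], ?_⟩
    rw [hM, average_eq]
    symm
    rw [div_eq_zero_iff]
    left
    refine (mul_eq_zero.1 ?_).resolve_left hcard.ne'
    rw [card_mul_form_chainHamiltonian hk]
    refine Finset.sum_eq_zero fun j _ => Finset.sum_eq_zero fun x _ => ?_
    rw [hslice hD.le]
    -- With `ω = 1` the windows that wrap around are uncut as well, so `h₀` annihilates every slice.
    exact form_eq_zero_of_mulVec ((hker _).2 ((isCut_slice hk A 1 j x).2 rfl))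
  have hneg : ∃ E ∈ tiMpsEnergies (chainHamiltonian n h) (D + 1), E < 0 := by
    refine ⟨_, ⟨B, hψ0, rfl⟩, ?_⟩
    rw [average_eq]
    refine div_neg_of_neg_of_pos ?_ (nsq_pos hψ0)
    refine neg_of_mul_neg_right ?_ hcard.le
    rw [card_mul_form_chainHamiltonian hk]
    simp only [hh, form_sub_smul_proj, Finset.sum_sub_distrib, ← Finset.mul_sum]
    rw [← hψ, ← hE₀, ← hV, div_mul_cancel₀ _ hVpos.ne']
    linarith
  refine ⟨chainHamiltonian n h,
    isLocalHamiltonian_chainHamiltonian hk (isHermitian_sub_smul_proj hh₀.1 _ _),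
    isTranslationInvariant_chainHamiltonian h, ?_, ?_⟩
  · obtain ⟨E, hE, hE0⟩ := hneg
    exact energyChain_of_plateau hD' hD
      (fun b hb => (tiMpsEnergies_nonempty hd _ hb).mono (tiMpsEnergies_subset _ b))
      (fun b => bddBelow_mpsEnergies _ b) hnonneg ⟨c, hc, hpos⟩
      (fun b h1 h2 => tiMpsEnergies_subset _ b (hzero b h1 h2))
      ⟨E, tiMpsEnergies_subset _ _ hE, hE0⟩
  · exact energyChain_of_plateau hD' hD (fun b hb => tiMpsEnergies_nonempty hd _ hb)
      (fun b => (bddBelow_mpsEnergies _ b).mono (tiMpsEnergies_subset _ b))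
      (fun b hb E hE => hnonneg b hb E (tiMpsEnergies_subset _ b hE))
      ⟨c, hc, fun E hE => hpos E (tiMpsEnergies_subset _ _ hE)⟩ hzero hneg

end plateau

/-! ### The staircase of matrix units. -/

section staircase

theorem isChain_of_prod_ne_zero {α M : Type*} [MonoidWithZero M] (f : α → M) (l : List α)
    (h : (l.map f).prod ≠ 0) : l.IsChain fun a b => f a * f b ≠ 0 := by
  induction l with
  | nil => exact List.IsChain.nil
  | cons a l ih =>
    have hl : (l.map f).prod ≠ 0 := by
      intro h0
      rw [List.map_cons, List.prod_cons, h0, mul_zero] at h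
      exact h rfl
    cases l with
    | nil => exact List.IsChain.singleton a
    | cons b l =>
      rw [List.isChain_cons_cons]
      refine ⟨fun h0 => h ?_, ih hl⟩
      rw [List.map_cons, List.map_cons, List.prod_cons, List.prod_cons, ← mul_assoc, h0, zero_mul]

theorem perm_eq_one_of_monotone {N : ℕ} {π : Equiv.Perm (Fin N)} (h : Monotone π) : π = 1 := by
  have h1 : StrictMono π := h.strictMono_of_injective π.injective
  have h2 : StrictMono π.symm := by
    intro a b hab
    by_contra hle
    have := h (not_lt.1 hle)
    rw [Equiv.apply_symm_apply, Equiv.apply_symm_apply] at this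
    exact absurd hab (not_lt.2 this)
  ext1 i
  refine le_antisymm ?_ h1.le_apply
  have := h2.le_apply (x := π i)
  rwa [Equiv.symm_apply_apply] at this

variable {ι : Type*} [Fintype ι] [DecidableEq ι]

/-- The staircase `E_{00} E_{01} E_{11} E_{12} ⋯` of matrix units has nonzero product in this order
only. -/
theorem prod_staircase_eq_zero {b : ℕ} {v : ℕ → ι} (hv : Set.InjOn v (Set.Iic b))
    {Y : Fin (2 * b) → Matrix ι ι ℂ}
    (hY : ∀ q, Y q = Matrix.single (v (q / 2)) (v ((q + 1) / 2)) 1)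
    {π : Equiv.Perm (Fin (2 * b))} (hπ : π ≠ 1) : (List.ofFn fun q => Y (π q)).prod = 0 := by
  by_contra h
  apply hπ
  have h1 := isChain_of_prod_ne_zero Y (List.ofFn π) (by rwa [List.map_ofFn])
  have h2 : (List.ofFn π).IsChain (· ≤ ·) := by
    refine h1.imp fun x y hxy => ?_
    by_contra hle
    apply hxy
    rw [hY, hY, Matrix.single_mul_single_of_ne]
    intro he
    -- Factor `x` can be followed by `y` only if `(x + 1) / 2 = y / 2`, which forces `x ≤ y`. A
    -- permutation all of whose steps go up is the identity.
    have := hv (show ((x : ℕ) + 1) / 2 ≤ b by omega) (show (y : ℕ) / 2 ≤ b by omega) he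
    rw [not_le, Fin.lt_def] at hle
    omega
  rw [List.isChain_iff_pairwise, List.pairwise_ofFn] at h2
  refine perm_eq_one_of_monotone fun i j hij => ?_
  rcases hij.eq_or_lt with rfl | hlt
  · exact le_rfl
  · exact h2 hlt

theorem prod_staircase {b : ℕ} (hb : 0 < b) {v : ℕ → ι} {Y : Fin (2 * b) → Matrix ι ι ℂ}
    (hY : ∀ q, Y q = Matrix.single (v (q / 2)) (v ((q + 1) / 2)) 1) :
    (List.ofFn Y).prod = Matrix.single (v 0) (v b) 1 := by
  have key : ∀ m, ((List.range (m + 1)).map fun q =>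
      (Matrix.single (v (q / 2)) (v ((q + 1) / 2)) 1 : Matrix ι ι ℂ)).prod =
        Matrix.single (v 0) (v ((m + 1) / 2)) 1 := by
    intro m
    induction m with
    | zero => simp
    | succ m ih =>
      rw [List.range_succ, List.map_append, List.prod_append, ih]
      simp
  obtain ⟨c, rfl⟩ := Nat.exists_eq_succ_of_ne_zero hb.ne'
  have h1 := key (2 * c + 1)
  have h2 : List.ofFn Y = (List.range (2 * (c + 1))).map fun q =>
      (Matrix.single (v (q / 2)) (v ((q + 1) / 2)) 1 : Matrix ι ι ℂ) := by
    apply List.ext_getElem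
    · rw [List.length_ofFn, List.length_map, List.length_range]
    · intro i h1 h2
      simp only [List.getElem_ofFn, List.getElem_map, List.getElem_range, hY]
  have h3 : (2 * c + 1 + 1) / 2 = c + 1 := by omega
  rw [h3] at h1
  rw [h2]
  exact h1

end staircase

/-! ### Matrices of 0 and 1 from partial automata. -/

section automata

variable {d p : ℕ}

/-- The transition matrices of a partial automaton. -/
def transition (step : Fin d → Fin p → Option (Fin p)) : Fin d → Matrix (Fin p) (Fin p) ℂ :=
  fun a => Matrix.of fun i j => if step a i = some j then 1 else 0

/-- The state of a partial automaton after reading a word. -/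
def run (step : Fin d → Fin p → Option (Fin p)) : List (Fin d) → Fin p → Option (Fin p)
  | [], i => some i
  | a :: L, i => (step a i).bind (run step L)

variable {step : Fin d → Fin p → Option (Fin p)}

theorem run_append (L L' : List (Fin d)) (i : Fin p) :
    run step (L ++ L') i = (run step L i).bind (run step L') := by
  induction L generalizing i with
  | nil => rfl
  | cons a L ih =>
    rw [List.cons_append, run, run, Option.bind_assoc]
    congr 1
    funext j
    exact ih j

theorem run_append_of_eq {L L' : List (Fin d)} {i j l : Fin p} (h : run step L i = some j)
    (h' : run step L' j = some l) : run step (L ++ L') i = some l := by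
  rw [run_append, h]
  exact h'

theorem listWord_transition (L : List (Fin d)) (i j : Fin p) :
    listWord (transition step) L i j = if run step L i = some j then 1 else 0 := by
  induction L generalizing i with
  | nil => simp [run, Matrix.one_apply]
  | cons a L ih =>
    rw [listWord_cons, Matrix.mul_apply, run]
    simp only [ih, transition, Matrix.of_apply]
    cases h : step a i with
    | none => simp
    | some l =>
      rw [Finset.sum_eq_single l]
      · simp
      · intro j' _ hj'
        simp [Ne.symm hj']
      · simp

/-- A word that can be read from one state only acts as a matrix unit; the staircases are built from
such words. -/
theorem listWord_eq_single {L : List (Fin d)} {i j : Fin p} (h : run step L i = some j)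
    (h' : ∀ i', i' ≠ i → run step L i' = none) :
    listWord (transition step) L = Matrix.single i j 1 := by
  ext x y
  rw [listWord_transition, Matrix.single_apply]
  by_cases hx : x = i
  · subst hx
    rw [h]
    simp
  · rw [h' x hx]
    simp [Ne.symm hx]

theorem exists_run_of_listWord_ne_zero {L : List (Fin d)}
    (h : listWord (transition step) L ≠ 0) : ∃ i j, run step L i = some j := by
  by_contra! hne
  apply h
  ext i j
  rw [listWord_transition, if_neg (hne i j), Matrix.zero_apply]

/-- Every state has `r` outgoing and `r` incoming edges, and each letter acts injectively. So `∑ A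
A†` and `∑ A† A` both equal `r`, and after division by `√r` the maximally mixed `σ` is stationary.
-/
theorem isIMPS_transition {r : ℕ} (hr : 0 < r) (hp : 0 < p)
    (hinj : ∀ a i i' j, step a i = some j → step a i' = some j → i = i')
    (hout : ∀ i, (Finset.univ.filter fun a => step a i ≠ none).card = r)
    (hin : ∀ j, (Finset.univ.filter fun q : Fin d × Fin p => step q.1 q.2 = some j).card = r) :
    IsIMPS ((((Real.sqrt r)⁻¹ : ℝ) : ℂ) • transition step)
      (((p : ℂ)⁻¹) • (1 : Matrix (Fin p) (Fin p) ℂ)) := by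
  have hs : star (((Real.sqrt r)⁻¹ : ℝ) : ℂ) * (((Real.sqrt r)⁻¹ : ℝ) : ℂ) = (r : ℂ)⁻¹ := by
    rw [Complex.star_def, Complex.conj_ofReal, ← Complex.ofReal_mul, ← mul_inv,
      Real.mul_self_sqrt (Nat.cast_nonneg r)]
    simp
  set s : ℂ := (((Real.sqrt r)⁻¹ : ℝ) : ℂ)
  have hr0 : (r : ℂ) ≠ 0 := by exact_mod_cast hr.ne'
  have hp0 : (p : ℂ) ≠ 0 := by exact_mod_cast hp.ne'
  have h1 : ∑ a, transition step a * (transition step a).conjTranspose =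
      (r : ℂ) • (1 : Matrix (Fin p) (Fin p) ℂ) := by
    ext i i'
    rw [Matrix.sum_apply, Matrix.smul_apply, Matrix.one_apply]
    simp only [Matrix.mul_apply, Matrix.conjTranspose_apply, transition, Matrix.of_apply]
    by_cases hii : i = i'
    · subst hii
      rw [if_pos rfl, ← hout i, Finset.card_filter, smul_eq_mul, mul_one, Nat.cast_sum]
      refine Finset.sum_congr rfl fun a _ => ?_
      cases h : step a i with
      | none => simp
      | some l => simp
    · rw [if_neg hii, smul_zero]
      refine Finset.sum_eq_zero fun a _ => Finset.sum_eq_zero fun j _ => ?_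
      by_cases h2 : step a i = some j
      · rw [if_neg fun h3 => hii (hinj a i i' j h2 h3)]
        simp
      · simp [h2]
  have h2 : ∑ a, (transition step a).conjTranspose * transition step a =
      (r : ℂ) • (1 : Matrix (Fin p) (Fin p) ℂ) := by
    ext j j'
    rw [Matrix.sum_apply, Matrix.smul_apply, Matrix.one_apply]
    simp only [Matrix.mul_apply, Matrix.conjTranspose_apply, transition, Matrix.of_apply]
    by_cases hjj : j = j'
    · subst hjj
      rw [if_pos rfl, ← hin j, Finset.card_filter, smul_eq_mul, mul_one, Nat.cast_sum,
        Fintype.sum_prod_type]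
      refine Finset.sum_congr rfl fun a _ => Finset.sum_congr rfl fun i _ => ?_
      split_ifs <;> simp
    · rw [if_neg hjj, smul_zero]
      refine Finset.sum_eq_zero fun a _ => Finset.sum_eq_zero fun i _ => ?_
      by_cases h3 : step a i = some j
      · rw [if_neg (c := step a i = some j') (by rw [h3]; simpa using hjj), mul_zero]
      · simp [h3]
  have hps : (1 : Matrix (Fin p) (Fin p) ℂ).PosSemidef := Matrix.PosSemidef.one
  refine ⟨?_, hps.smul (by positivity), ?_, ?_⟩
  · simp only [Pi.smul_apply, Matrix.conjTranspose_smul, smul_mul_smul_comm, mul_comm s, hs]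
    rw [← Finset.smul_sum, h1, smul_smul, inv_mul_cancel₀ hr0, one_smul]
  · rw [Matrix.trace_smul, Matrix.trace_one, Fintype.card_fin, smul_eq_mul, inv_mul_cancel₀ hp0]
  · simp only [Pi.smul_apply, Matrix.conjTranspose_smul, Matrix.mul_smul, mul_one,
      Matrix.smul_mul, smul_smul]
    have h3 : s * ((p : ℂ)⁻¹ * star s) = (p : ℂ)⁻¹ * (r : ℂ)⁻¹ := by
      rw [← hs]
      ring
    rw [h3, ← Finset.smul_sum, h2, smul_smul, mul_assoc, inv_mul_cancel₀ hr0, mul_one]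

end automata

section vertices

/-- The vertex `m` of a cycle with `b + 1` vertices. -/
def vtx (b m : ℕ) : Fin (b + 1) := Fin.ofNat (b + 1) m

theorem vtx_val (b m : ℕ) : (vtx b m : ℕ) = m % (b + 1) := rfl

theorem vtx_eq_iff {b m m' : ℕ} : vtx b m = vtx b m' ↔ m % (b + 1) = m' % (b + 1) := by
  rw [Fin.ext_iff, vtx_val, vtx_val]

theorem vtx_succ (b m : ℕ) : vtx b m + 1 = vtx b (m + 1) := by
  apply Fin.ext
  rw [Fin.val_add, vtx_val, vtx_val, Fin.val_one', ← Nat.add_mod]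

theorem vtx_coe {b : ℕ} (i : Fin (b + 1)) : vtx b i = i := by
  apply Fin.ext
  rw [vtx_val, Nat.mod_eq_of_lt i.2]

theorem vtx_zero (b : ℕ) : vtx b 0 = 0 := rfl

theorem vtx_self (b : ℕ) : vtx b b = Fin.last b := by
  apply Fin.ext
  rw [vtx_val, Nat.mod_eq_of_lt (Nat.lt_succ_self b), Fin.val_last]

theorem vtx_injOn (b : ℕ) : Set.InjOn (vtx b) (Set.Iic b) := by
  intro m hm m' hm' h
  rw [Set.mem_Iic] at hm hm'
  rwa [vtx_eq_iff, Nat.mod_eq_of_lt (by omega), Nat.mod_eq_of_lt (by omega)] at h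

theorem mps_ne_zero {b d n : ℕ} {A : Fin d → Matrix (Fin b) (Fin b) ℂ} {L : List (Fin d)}
    (hL : L.length = n) (h : (listWord A L).trace ≠ 0) : mps n 1 A ≠ 0 := by
  subst hL
  intro h0
  apply h
  have := congrFun h0 L.get
  rwa [mps, one_mul, word_eq_listWord, List.ofFn_get] at this

end vertices

theorem sum_add_mod_two (c e : ℕ) : ∑ q : Fin (2 * c), (e + (q : ℕ) % 2) = c * (2 * e + 1) := by
  rw [Fin.sum_univ_eq_sum_range fun q => e + q % 2]
  induction c with
  | zero => simp
  | succ c ih =>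
    rw [show 2 * (c + 1) = 2 * c + 1 + 1 by ring, Finset.sum_range_succ, Finset.sum_range_succ,
      ih, show (2 * c) % 2 = 0 by omega, show (2 * c + 1) % 2 = 1 by omega]
    ring

/-! ### The cycle with loops, for physical dimension `2 D`. -/

section loops

variable {b d : ℕ}

/-- The automaton on a cycle that stays at `i` on reading `α i` and moves on from `i` on reading
`β i`. -/
def loopStep (α β : Fin (b + 1) → Fin d) (a : Fin d) (i : Fin (b + 1)) : Option (Fin (b + 1)) :=
  if a = α i then some i else if a = β i then some (i + 1) else none

variable {α β : Fin (b + 1) → Fin d}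

theorem loopStep_eq_some (hαβ : ∀ i, α i ≠ β i) {a : Fin d} {i j : Fin (b + 1)} :
    loopStep α β a i = some j ↔ (a = α i ∧ i = j) ∨ (a = β i ∧ i + 1 = j) := by
  unfold loopStep
  split_ifs with h1 h2
  · have : a ≠ β i := fun h => hαβ i (h1.symm.trans h)
    simp [h1, hαβ i]
  · simp [h2, (hαβ i).symm]
  · simp [h1, h2]

/-- A loop and a move may share a letter; `hne` only excludes that they end at the same vertex,
which keeps each letter injective. -/
theorem isIMPS_loopStep (hb : 0 < b) (hαβ : ∀ i, α i ≠ β i)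
    (hne : ∀ i i', α i = β i' → i ≠ i' + 1) :
    IsIMPS ((((Real.sqrt (2 : ℕ))⁻¹ : ℝ) : ℂ) • transition (loopStep α β))
      ((((b + 1 : ℕ) : ℂ)⁻¹) • (1 : Matrix (Fin (b + 1)) (Fin (b + 1)) ℂ)) := by
  refine isIMPS_transition two_pos (Nat.succ_pos b) ?_ ?_ ?_
  · intro a i i' j h h'
    rw [loopStep_eq_some hαβ] at h h'
    rcases h with ⟨h1, h2⟩ | ⟨h1, h2⟩ <;> rcases h' with ⟨h3, h4⟩ | ⟨h3, h4⟩
    · rw [h2, h4]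
    · exact absurd (h2.trans h4.symm) (hne i i' (h1.symm.trans h3))
    · exact absurd (h4.trans h2.symm) (hne i' i (h3.symm.trans h1))
    · exact add_right_cancel (h2.trans h4.symm)
  · intro i
    have : (Finset.univ.filter fun a => loopStep α β a i ≠ none) = {α i, β i} := by
      ext a
      rw [Finset.mem_filter, Finset.mem_insert, Finset.mem_singleton, loopStep]
      split_ifs with h1 h2 <;> simp [*]
    rw [this, Finset.card_pair (hαβ i)]
  · intro j
    have : (Finset.univ.filter fun q : Fin d × Fin (b + 1) => loopStep α β q.1 q.2 = some j) =
        {(α j, j), (β (j - 1), j - 1)} := by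
      ext ⟨a, i⟩
      simp only [Finset.mem_filter, Finset.mem_univ, true_and, Finset.mem_insert,
        Finset.mem_singleton, loopStep_eq_some hαβ, Prod.mk.injEq]
      constructor
      · rintro (⟨rfl, rfl⟩ | ⟨rfl, rfl⟩)
        · exact Or.inl ⟨rfl, rfl⟩
        · right
          rw [add_sub_cancel_right]
          exact ⟨rfl, rfl⟩
      · rintro (⟨rfl, rfl⟩ | ⟨rfl, rfl⟩)
        · exact Or.inl ⟨rfl, rfl⟩
        · exact Or.inr ⟨rfl, sub_add_cancel _ _⟩
    rw [this, Finset.card_pair]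
    intro h
    have h1 := (Prod.mk.inj h).2
    have h2 : (1 : Fin (b + 1)) = 0 := by
      rwa [eq_comm, sub_eq_self] at h1
    have h3 := congrArg Fin.val h2
    rw [Fin.val_one', Nat.mod_eq_of_lt (by omega), Fin.val_zero] at h3
    omega

/-- The words `α_0, α_0 β_0, α_1, α_1 β_1, …` of the loop automaton. -/
def loopWord (α β : Fin (b + 1) → Fin d) (q : Fin (2 * b)) : List (Fin d) :=
  if (q : ℕ) % 2 = 0 then [α (vtx b (q / 2))] else [α (vtx b (q / 2)), β (vtx b (q / 2))]

theorem length_shuffle_loopWord (α β : Fin (b + 1) → Fin d) :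
    (shuffle (loopWord α β) 1).length = 3 * b := by
  have h1 : ∀ q : Fin (2 * b), (loopWord α β q).length = 1 + q % 2 := by
    intro q
    unfold loopWord
    split_ifs with h
    · simp [h]
    · simp
      omega
  rw [length_shuffle]
  simp only [h1]
  rw [sum_add_mod_two]
  ring

/-- The letter `α i` with `i < b` is readable only at `i`, so a leading `α i` fixes the starting
vertex. This is why the moves in `loopWord` are preceded by a loop. -/
theorem run_loop_of_ne (hα : Function.Injective α)
    (hu : ∀ i i' : Fin (b + 1), (i : ℕ) < b → α i ≠ β i') {i i' : Fin (b + 1)} (hi : (i : ℕ) < b)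
    (h : i' ≠ i) (L : List (Fin d)) : run (loopStep α β) (α i :: L) i' = none := by
  rw [run, loopStep, if_neg fun e => h (hα e).symm, if_neg (hu i i' hi)]
  rfl

theorem loopStep_loop (α β : Fin (b + 1) → Fin d) (i : Fin (b + 1)) :
    loopStep α β (α i) i = some i := if_pos rfl

theorem loopStep_move (hαβ : ∀ i, α i ≠ β i) (i : Fin (b + 1)) :
    loopStep α β (β i) i = some (i + 1) := by
  rw [loopStep, if_neg (hαβ i).symm, if_pos rfl]

theorem listWord_loopWord (hαβ : ∀ i, α i ≠ β i) (hα : Function.Injective α)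
    (hu : ∀ i i' : Fin (b + 1), (i : ℕ) < b → α i ≠ β i') (q : Fin (2 * b)) :
    listWord (transition (loopStep α β)) (loopWord α β q) =
      Matrix.single (vtx b (q / 2)) (vtx b ((q + 1) / 2)) 1 := by
  have hq : (vtx b (q / 2) : ℕ) < b := by
    rw [vtx_val, Nat.mod_eq_of_lt (by omega)]
    omega
  unfold loopWord
  split_ifs with h
  · refine listWord_eq_single ?_ fun i' hi' => run_loop_of_ne hα hu hq hi' _
    rw [run, loopStep_loop, show ((q : ℕ) + 1) / 2 = q / 2 by omega]
    rfl
  · refine listWord_eq_single ?_ fun i' hi' => run_loop_of_ne hα hu hq hi' _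
    rw [run, loopStep_loop, Option.bind_some, run, loopStep_move hαβ, Option.bind_some, run,
      vtx_succ, show ((q : ℕ) + 1) / 2 = q / 2 + 1 by omega]

theorem listWord_shuffle_loopWord_eq_zero (hαβ : ∀ i, α i ≠ β i) (hα : Function.Injective α)
    (hu : ∀ i i' : Fin (b + 1), (i : ℕ) < b → α i ≠ β i') {π : Equiv.Perm (Fin (2 * b))}
    (hπ : π ≠ 1) : listWord (transition (loopStep α β)) (shuffle (loopWord α β) π) = 0 := by
  rw [listWord_shuffle]
  exact prod_staircase_eq_zero (vtx_injOn b) (listWord_loopWord hαβ hα hu) hπ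

theorem listWord_shuffle_loopWord_one (hb : 0 < b) (hαβ : ∀ i, α i ≠ β i)
    (hα : Function.Injective α) (hu : ∀ i i' : Fin (b + 1), (i : ℕ) < b → α i ≠ β i') :
    listWord (transition (loopStep α β)) (shuffle (loopWord α β) 1) =
      Matrix.single 0 (Fin.last b) 1 := by
  rw [listWord_shuffle, ← vtx_zero, ← vtx_self]
  exact prod_staircase hb (listWord_loopWord hαβ hα hu)

theorem run_loop_return (hαβ : ∀ i, α i ≠ β i) :
    run (loopStep α β) [β (Fin.last b), α 0] (Fin.last b) = some 0 := by
  rw [run, loopStep_move hαβ, Option.bind_some, Fin.last_add_one, run, loopStep_loop]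
  rfl

theorem run_loop_replicate (α β : Fin (b + 1) → Fin d) (r : ℕ) :
    run (loopStep α β) (List.replicate r (α 0)) 0 = some 0 := by
  induction r with
  | zero => rfl
  | succ r ih => rw [List.replicate_succ, run, loopStep_loop, Option.bind_some, ih]

theorem isDetectedFamily_loop (hb : 0 < b) (hαβ : ∀ i, α i ≠ β i)
    (hα : Function.Injective α) (hne : ∀ i i', α i = β i' → i ≠ i' + 1)
    (hu : ∀ i i' : Fin (b + 1), (i : ℕ) < b → α i ≠ β i') :
    IsDetectedFamily (6 * b + 4) (transition (loopStep α β)) (loopWord α β)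
      [β (Fin.last b), α 0] where
  length_eq := by
    rw [length_shuffle_loopWord]
    simp
    ring
  shuffle_eq_zero := fun π hπ => listWord_shuffle_loopWord_eq_zero hαβ hα hu hπ
  shuffle_one := by
    -- The letter `β (Fin.last b)` may also be a move elsewhere. The following `α 0` rejects every
    -- run that does not arrive at vertex `0`.
    have hR : listWord (transition (loopStep α β)) [β (Fin.last b), α 0] =
        Matrix.single (Fin.last b) 0 1 := by
      refine listWord_eq_single (run_loop_return hαβ) fun i' hi' => ?_
      rw [run]
      cases h : loopStep α β (β (Fin.last b)) i' with
      | none => rfl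
      | some j =>
        rw [Option.bind_some]
        refine run_loop_of_ne hα hu hb ?_ _
        rintro rfl
        rw [loopStep_eq_some hαβ] at h
        rcases h with ⟨h1, rfl⟩ | ⟨-, h2⟩
        · exact hu 0 (Fin.last b) hb h1.symm
        · rw [← Fin.last_add_one b] at h2
          exact hi' (add_right_cancel h2)
    rw [listWord_append, listWord_shuffle_loopWord_one hb hαβ hα hu, hR]
    simp
  imps := by
    refine ⟨_, _, ?_, isIMPS_loopStep hb hαβ hne, ?_⟩
    · simp
    · rw [Matrix.smul_apply, Matrix.one_apply_eq, smul_eq_mul, mul_one]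
      exact inv_ne_zero (by exact_mod_cast Nat.succ_ne_zero b)

theorem exists_run_move (hαβ : ∀ i, α i ≠ β i) (m c : ℕ) :
    ∃ y : List (Fin d), y.length = m ∧
      run (loopStep α β) y (vtx b c) = some (vtx b (c + m)) := by
  induction m generalizing c with
  | zero => exact ⟨[], rfl, rfl⟩
  | succ m ih =>
    obtain ⟨y, hy, hr⟩ := ih (c + 1)
    refine ⟨β (vtx b c) :: y, by rw [List.length_cons, hy], ?_⟩
    rw [run, loopStep_move hαβ, Option.bind_some, vtx_succ, hr, add_right_comm, add_assoc]

/-- With all letters distinct, the first letter determines the start, so every readable nonempty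
word is a matrix unit `E_ij`. It suffices to exhibit one word of length `k` from `i` to `j` that
passes through the ordered staircase. -/
theorem isRigidFamily_loop {k : ℕ} (hb : 0 < b) (hk : 5 * b + 4 ≤ k) (hα : Function.Injective α)
    (hβ : Function.Injective β) (hαβ : ∀ i i', α i ≠ β i') :
    IsRigidFamily (p := b + 1) k (transition (loopStep α β)) (loopWord α β) where
  shuffle_eq_zero := fun π hπ =>
    listWord_shuffle_loopWord_eq_zero (fun i => hαβ i i) hα (fun i i' _ => hαβ i i') hπ
  cover := by
    have hd : ∀ i, α i ≠ β i := fun i => hαβ i i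
    have hu : ∀ i i' : Fin (b + 1), (i : ℕ) < b → α i ≠ β i' := fun i i' _ => hαβ i i'
    intro L hL
    refine or_iff_not_imp_left.2 fun hL0 => ?_
    obtain ⟨i, j, hij⟩ := exists_run_of_listWord_ne_zero hL0
    have huniq : ∀ {L' : List (Fin d)} {i₁ j₁ i₂ : Fin (b + 1)}, L' ≠ [] →
        run (loopStep α β) L' i₁ = some j₁ → i₂ ≠ i₁ → run (loopStep α β) L' i₂ = none := by
      intro L' i₁ j₁ i₂ hne h1 h2
      cases L' with
      | nil => exact absurd rfl hne
      | cons a L' =>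
        rw [run] at h1 ⊢
        have h3 : loopStep α β a i₂ = none := by
          rw [Option.bind_eq_some_iff] at h1
          obtain ⟨l, hl, -⟩ := h1
          rw [loopStep_eq_some hd] at hl
          rw [loopStep]
          rcases hl with ⟨rfl, -⟩ | ⟨rfl, -⟩
          · rw [if_neg fun e => h2 (hα e).symm, if_neg (hαβ _ _)]
          · rw [if_neg (hαβ _ _).symm, if_neg fun e => h2 (hβ e).symm]
        rw [h3]
        rfl
    obtain ⟨y, hy, hyr⟩ := exists_run_move (b := b) hd (b + 1 - i) i
    obtain ⟨z, hz, hzr⟩ := exists_run_move (b := b) hd j 0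
    have hi := i.2
    have hj := j.2
    rw [vtx_coe, show (i : ℕ) + (b + 1 - i) = b + 1 by omega,
      show vtx b (b + 1) = 0 by rw [← vtx_zero, vtx_eq_iff]; simp] at hyr
    rw [vtx_zero, zero_add, vtx_coe] at hzr
    have hX : run (loopStep α β) (shuffle (loopWord α β) 1) 0 = some (Fin.last b) := by
      have h1 := listWord_transition (step := loopStep α β) (shuffle (loopWord α β) 1) 0
        (Fin.last b)
      rw [listWord_shuffle_loopWord_one hb hd hα hu, Matrix.single_apply_same] at h1
      by_contra hne
      rw [if_neg hne] at h1
      exact one_ne_zero h1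
    -- The path goes from `i` to `0`, along the staircase, back to `0`, then waits `r` steps and
    -- moves on to `j`. Without waiting its length is `(b + 1 - i) + 3 b + 2 + j`, below `5 b + 4`.
    set r := k - (4 * b + 3 - i + j) with hr
    have hlen : (y ++ shuffle (loopWord α β) 1 ++ ([β (Fin.last b), α 0] ++
        (List.replicate r (α 0) ++ z))).length = k := by
      simp only [List.length_append, List.length_replicate, hy, hz, List.length_cons,
        List.length_nil, length_shuffle_loopWord]
      omega
    refine ⟨y, [β (Fin.last b), α 0] ++ (List.replicate r (α 0) ++ z), 1, hlen, ?_⟩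
    have hrun : run (loopStep α β) (y ++ shuffle (loopWord α β) 1 ++ ([β (Fin.last b), α 0] ++
        (List.replicate r (α 0) ++ z))) i = some j :=
      run_append_of_eq (run_append_of_eq hyr hX) (run_append_of_eq (run_loop_return hd)
        (run_append_of_eq (run_loop_replicate α β r) hzr))
    have hne : ∀ L' : List (Fin d), L'.length = k → L' ≠ [] := by
      rintro L' h1 rfl
      rw [List.length_nil] at h1
      omega
    rw [one_smul, listWord_eq_single hij fun i' hi' => huniq (hne _ hL) hij hi',
      listWord_eq_single hrun fun i' hi' => huniq (hne _ hlen) hrun hi']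
  imps := ⟨_, _, isIMPS_loopStep hb (fun i => hαβ i i) fun i i' h => absurd h (hαβ i i')⟩

theorem mps_loop_ne_zero {n : ℕ} (hn : 0 < n) (hb : 0 < b)
    (hα : Function.Injective α) (hu : ∀ i i' : Fin (b + 1), (i : ℕ) < b → α i ≠ β i') :
    mps n 1 (transition (loopStep α β)) ≠ 0 := by
  refine mps_ne_zero (L := List.replicate n (α 0)) (List.length_replicate) ?_
  obtain ⟨m, rfl⟩ := Nat.exists_eq_succ_of_ne_zero hn.ne'
  rw [listWord_eq_single (run_loop_replicate α β _) fun i' hi' => ?_]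
  · simp
  · rw [List.replicate_succ]
    exact run_loop_of_ne hα hu hb hi' _

end loops

/-! ### The cycle with one marked vertex, for qubits. -/

section cycles

variable {b d : ℕ}

/-- The automaton on a cycle that moves on from `i` on reading `β i`. -/
def cycleStep (β : Fin (b + 1) → Fin d) (a : Fin d) (i : Fin (b + 1)) : Option (Fin (b + 1)) :=
  if a = β i then some (i + 1) else none

/-- The word of length `m` that the cycle automaton reads from the vertex `c`. -/
def cycleWord (β : Fin (b + 1) → Fin d) (c m : ℕ) : List (Fin d) :=
  (List.range m).map fun l => β (vtx b (c + l))

variable {β : Fin (b + 1) → Fin d}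

theorem isIMPS_cycleStep (β : Fin (b + 1) → Fin d) :
    IsIMPS ((((Real.sqrt (1 : ℕ))⁻¹ : ℝ) : ℂ) • transition (cycleStep β))
      ((((b + 1 : ℕ) : ℂ)⁻¹) • (1 : Matrix (Fin (b + 1)) (Fin (b + 1)) ℂ)) := by
  have hstep : ∀ {a i j}, cycleStep β a i = some j ↔ a = β i ∧ i + 1 = j := by
    intro a i j
    unfold cycleStep
    split_ifs with h <;> simp [h]
  refine isIMPS_transition one_pos (Nat.succ_pos b) ?_ ?_ ?_
  · intro a i i' j h h'
    exact add_right_cancel ((hstep.1 h).2.trans (hstep.1 h').2.symm)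
  · intro i
    rw [Finset.card_eq_one]
    refine ⟨β i, ?_⟩
    ext a
    simp [cycleStep]
  · intro j
    rw [Finset.card_eq_one]
    refine ⟨(β (j - 1), j - 1), ?_⟩
    ext ⟨a, i⟩
    simp only [Finset.mem_filter, Finset.mem_univ, true_and, Finset.mem_singleton, hstep,
      Prod.mk.injEq]
    constructor
    · rintro ⟨rfl, rfl⟩
      rw [add_sub_cancel_right]
      exact ⟨rfl, rfl⟩
    · rintro ⟨rfl, rfl⟩
      exact ⟨rfl, sub_add_cancel _ _⟩

theorem length_cycleWord (c m : ℕ) : (cycleWord β c m).length = m := by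
  simp [cycleWord]

theorem cycleWord_succ (c m : ℕ) :
    cycleWord β c (m + 1) = β (vtx b c) :: cycleWord β (c + 1) m := by
  rw [cycleWord, List.range_succ_eq_map, List.map_cons, List.map_map, cycleWord, add_zero]
  congr 1
  refine List.map_congr_left fun l _ => ?_
  rw [Function.comp_apply, Nat.succ_eq_add_one, add_right_comm, add_assoc]

theorem cycleWord_add (c m m' : ℕ) :
    cycleWord β c (m + m') = cycleWord β c m ++ cycleWord β (c + m) m' := by
  rw [cycleWord, List.range_add, List.map_append, List.map_map, cycleWord, cycleWord]
  congr 1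
  refine List.map_congr_left fun l _ => ?_
  rw [Function.comp_apply, add_assoc]

theorem cycleWord_congr {c c' : ℕ} (h : vtx b c = vtx b c') (m : ℕ) :
    cycleWord β c m = cycleWord β c' m := by
  refine List.map_congr_left fun l _ => ?_
  rw [vtx_eq_iff.2 (Nat.ModEq.add_right l (vtx_eq_iff.1 h))]

theorem run_cycleWord (c m : ℕ) :
    run (cycleStep β) (cycleWord β c m) (vtx b c) = some (vtx b (c + m)) := by
  induction m generalizing c with
  | zero => rfl
  | succ m ih =>
    rw [cycleWord_succ, run, cycleStep, if_pos rfl, Option.bind_some, vtx_succ, ih, add_right_comm,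
      add_assoc]

theorem eq_cycleWord_of_run {L : List (Fin d)} {c : ℕ}
    (h : run (cycleStep β) L (vtx b c) ≠ none) : L = cycleWord β c L.length := by
  induction L generalizing c with
  | nil => rfl
  | cons a L ih =>
    rw [run, cycleStep] at h
    split_ifs at h with h1
    · rw [Option.bind_some, vtx_succ] at h
      rw [List.length_cons, cycleWord_succ, ← ih h, h1]
    · exact absurd rfl h

/-- A full turn meets the marked letter `e`, and its position reveals the starting vertex. -/
theorem listWord_cycleWord {e : Fin d} (hβ : ∀ i, β i = e ↔ i = Fin.last b) {c m : ℕ}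
    (hm : b + 1 ≤ m) : listWord (transition (cycleStep β)) (cycleWord β c m) =
      Matrix.single (vtx b c) (vtx b (c + m)) 1 := by
  refine listWord_eq_single (run_cycleWord c m) fun i' hi' => ?_
  by_contra hne
  rw [← vtx_coe i'] at hne
  have h1 := eq_cycleWord_of_run hne
  rw [length_cycleWord] at h1
  apply hi'
  -- The first occurrence of `e` in the word read from `c` is at position `l`.
  set l := b - c % (b + 1) with hl
  have hc : c % (b + 1) < b + 1 := Nat.mod_lt c (Nat.succ_pos b)
  have hcl : c % (b + 1) + l = b := by omega
  have hlm : l < m := by omega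
  have h2 := congrArg (fun L => L[l]?) h1
  simp only [cycleWord, List.getElem?_map, List.getElem?_range hlm, Option.map_some,
    Option.some.injEq] at h2
  have h3 : vtx b (c + l) = Fin.last b := by
    rw [← vtx_self, vtx_eq_iff, ← Nat.mod_add_mod, hcl]
  have h4 : vtx b (i' + l) = Fin.last b := by
    rw [← hβ, ← h2, hβ, h3]
  rw [← vtx_coe i', vtx_eq_iff]
  exact Nat.ModEq.add_right_cancel' l (vtx_eq_iff.1 (h4.trans h3.symm))

/-- Words that lead from `q / 2` to `(q + 1) / 2` in the cycle automaton. -/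
def cycleFactor (β : Fin (b + 1) → Fin d) (q : Fin (2 * b)) : List (Fin d) :=
  -- The full turn makes the word a matrix unit; the extra `q % 2` decides between staying and
  -- moving on.
  cycleWord β (q / 2) (b + 1 + q % 2)

theorem length_shuffle_cycleFactor (β : Fin (b + 1) → Fin d) :
    (shuffle (cycleFactor β) 1).length = b * (2 * b + 3) := by
  rw [length_shuffle]
  simp only [cycleFactor, length_cycleWord]
  rw [sum_add_mod_two]
  ring

theorem listWord_cycleFactor {e : Fin d} (hβ : ∀ i, β i = e ↔ i = Fin.last b) (q : Fin (2 * b)) :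
    listWord (transition (cycleStep β)) (cycleFactor β q) =
      Matrix.single (vtx b (q / 2)) (vtx b ((q + 1) / 2)) 1 := by
  rw [cycleFactor, listWord_cycleWord hβ (by omega)]
  congr 1
  rw [vtx_eq_iff, show (q : ℕ) / 2 + (b + 1 + q % 2) = (q + 1) / 2 + (b + 1) by omega,
    Nat.add_mod_right]

theorem listWord_shuffle_cycleFactor_eq_zero {e : Fin d} (hβ : ∀ i, β i = e ↔ i = Fin.last b)
    {π : Equiv.Perm (Fin (2 * b))} (hπ : π ≠ 1) :
    listWord (transition (cycleStep β)) (shuffle (cycleFactor β) π) = 0 := by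
  rw [listWord_shuffle]
  exact prod_staircase_eq_zero (vtx_injOn b) (listWord_cycleFactor hβ) hπ

theorem listWord_shuffle_cycleFactor_one (hb : 0 < b) {e : Fin d}
    (hβ : ∀ i, β i = e ↔ i = Fin.last b) :
    listWord (transition (cycleStep β)) (shuffle (cycleFactor β) 1) =
      Matrix.single (vtx b 0) (vtx b b) 1 := by
  rw [listWord_shuffle]
  exact prod_staircase hb (listWord_cycleFactor hβ)

/-- The closing word makes one full turn and one further step, from `b` to `0`. The total length is
`2 (b (2 b + 3) + b + 2) = 4 (b + 1) ^ 2`. -/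
theorem isDetectedFamily_cycle (hb : 0 < b) {e : Fin d} (hβ : ∀ i, β i = e ↔ i = Fin.last b) :
    IsDetectedFamily (4 * (b + 1) ^ 2) (transition (cycleStep β)) (cycleFactor β)
      (cycleWord β b (b + 2)) where
  length_eq := by
    rw [length_shuffle_cycleFactor, length_cycleWord]
    ring
  shuffle_eq_zero := fun π hπ => listWord_shuffle_cycleFactor_eq_zero hβ hπ
  shuffle_one := by
    rw [listWord_append, listWord_shuffle_cycleFactor_one hb hβ, listWord_cycleWord hβ (by omega),
      Matrix.single_mul_single_same, mul_one]
    congr 1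
    rw [← vtx_zero, vtx_eq_iff, show b + (b + 2) = (b + 1) * 2 by ring]
    simp
  imps := by
    refine ⟨_, _, ?_, isIMPS_cycleStep β, ?_⟩
    · simp
    · rw [Matrix.smul_apply, Matrix.one_apply_eq, smul_eq_mul, mul_one]
      exact inv_ne_zero (by exact_mod_cast Nat.succ_ne_zero b)

/-- Each vertex admits just one word of length `k`. It returns to `0` within `b + 1` letters and
then has room for the ordered staircase, which is itself the word read from `0`. -/
theorem isRigidFamily_cycle {k : ℕ} (hb : 0 < b) (hk : b * (2 * b + 3) + (b + 1) ≤ k) {e : Fin d}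
    (hβ : ∀ i, β i = e ↔ i = Fin.last b) :
    IsRigidFamily (p := b + 1) k (transition (cycleStep β)) (cycleFactor β) where
  shuffle_eq_zero := fun π hπ => listWord_shuffle_cycleFactor_eq_zero hβ hπ
  cover := by
    intro L hL
    refine or_iff_not_imp_left.2 fun hL0 => ?_
    obtain ⟨i, j, hij⟩ := exists_run_of_listWord_ne_zero hL0
    rw [← vtx_coe i] at hij
    have h1 := eq_cycleWord_of_run (β := β) (c := i) (L := L) (by rw [hij]; simp)
    have hX : shuffle (cycleFactor β) 1 = cycleWord β 0 (b * (2 * b + 3)) := by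
      rw [← length_shuffle_cycleFactor β]
      apply eq_cycleWord_of_run
      intro hnone
      have h2 := listWord_transition (step := cycleStep β) (shuffle (cycleFactor β) 1) (vtx b 0)
        (vtx b b)
      rw [listWord_shuffle_cycleFactor_one hb hβ, Matrix.single_apply_same, hnone] at h2
      simp at h2
    set m := b * (2 * b + 3) with hm
    have hi := i.2
    have h3 : L = cycleWord β i (b + 1 - i) ++ shuffle (cycleFactor β) 1 ++
        cycleWord β (i + (b + 1 - i + m)) (k - (b + 1 - i + m)) := by
      rw [hX, cycleWord_congr (c := 0) (c' := i + (b + 1 - i)), ← cycleWord_add, ← cycleWord_add,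
        h1, hL]
      · congr 1
        omega
      · rw [vtx_eq_iff, show (i : ℕ) + (b + 1 - i) = b + 1 by omega]
        simp
    exact ⟨_, _, 1, by rw [← h3, hL], by rw [← h3, one_smul]⟩
  imps := ⟨_, _, isIMPS_cycleStep β⟩

theorem mps_cycle_ne_zero {n : ℕ} (hn : 0 < n) (hbn : b + 1 ∣ n) {e : Fin d}
    (hβ : ∀ i, β i = e ↔ i = Fin.last b) : mps n 1 (transition (cycleStep β)) ≠ 0 := by
  refine mps_ne_zero (L := cycleWord β 0 n) (length_cycleWord 0 n) ?_
  rw [listWord_cycleWord hβ (Nat.le_of_dvd hn hbn),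
    show vtx b (0 + n) = vtx b 0 by rw [vtx_eq_iff, zero_add, Nat.mod_eq_zero_of_dvd hbn]; simp]
  simp

end cycles

end MPSChain

/-! ### Choice of the families, lengths and constants. -/

theorem proposition1 :
    -- qubits, locality `O(D ^ 2)`
    (∃ C : ℕ, ∀ D D' : ℕ, 1 < D' → D' < D →
      -- finite chains, with arbitrary `ω` and with `ω = 1`
      (∀ N : ℕ, ∃ n > N, ∃ k ≤ C * D ^ 2, ∃ H : Matrix (Fin n → Fin 2) (Fin n → Fin 2) ℂ,
        MPSChain.IsLocalHamiltonian k H ∧ MPSChain.IsTranslationInvariant H ∧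
        MPSChain.EnergyChain (MPSChain.mpsEnergies H) D' D ∧
        MPSChain.EnergyChain (MPSChain.tiMpsEnergies H) D' D) ∧
      -- the infinite chain
      (∃ k ≤ C * D ^ 2, ∃ h : Matrix (Fin k → Fin 2) (Fin k → Fin 2) ℂ,
        h.IsHermitian ∧ MPSChain.EnergyChain (MPSChain.impsEnergies h) D' D)) ∧
    -- physical dimension `2 * D`, locality `O(D)`
    (∃ C : ℕ, ∀ D D' : ℕ, 1 < D' → D' < D →
      (∀ N : ℕ, ∃ n > N, ∃ k ≤ C * D,
        ∃ H : Matrix (Fin n → Fin (2 * D)) (Fin n → Fin (2 * D)) ℂ,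
        MPSChain.IsLocalHamiltonian k H ∧ MPSChain.IsTranslationInvariant H ∧
        MPSChain.EnergyChain (MPSChain.mpsEnergies H) D' D ∧
        MPSChain.EnergyChain (MPSChain.tiMpsEnergies H) D' D) ∧
      (∃ k ≤ C * D, ∃ h : Matrix (Fin k → Fin (2 * D)) (Fin k → Fin (2 * D)) ℂ,
        h.IsHermitian ∧ MPSChain.EnergyChain (MPSChain.impsEnergies h) D' D)) := by
  open MPSChain in
  constructor
  -- The locality `4 (D + 1) ^ 2` is at most `16 D ^ 2`.
  · refine ⟨16, fun D D' hD' hD => ?_⟩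
    obtain ⟨b, rfl⟩ := Nat.exists_eq_add_of_lt (show 0 < D' by omega)
    rw [zero_add] at hD' hD ⊢
    have hβ : ∀ {c : ℕ} (i : Fin (c + 1)), (if i = Fin.last c then (1 : Fin 2) else 0) = 1 ↔
        i = Fin.last c := by
      intro c i
      split_ifs with h <;> simp [h]
    have hk : 4 * (D + 1) ^ 2 ≤ 16 * D ^ 2 := by nlinarith
    have hA := isRigidFamily_cycle (b := b) (k := 4 * (D + 1) ^ 2) (by omega) (by nlinarith) hβ
    have hB := isDetectedFamily_cycle (b := D) (by omega) hβ
    refine ⟨fun N => ?_, 4 * (D + 1) ^ 2, hk,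
      exists_imps_energyChain two_pos hD' hD hA hB⟩
    -- Divisibility by `b + 1 = D'` keeps the state of `A` nonzero. Divisibility by `D + 1`, shared
    -- by `k`, lets the `n - k` sites outside a window close up for `B`.
    set n := (b + 1) * ((D + 1) * (4 * (D + 1) ^ 2 + N + 1)) with hn
    have hkn : 4 * (D + 1) ^ 2 + N + 1 ≤ n :=
      (Nat.le_mul_of_pos_left _ (Nat.succ_pos D)).trans (Nat.le_mul_of_pos_left _ (Nat.succ_pos b))
    have hdvd : D + 1 ∣ n - 4 * (D + 1) ^ 2 := by
      refine Nat.dvd_sub ?_ ?_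
      · exact Dvd.dvd.mul_left (Dvd.intro _ rfl) _
      · exact Dvd.dvd.mul_left (Dvd.intro_left _ (pow_succ (D + 1) 1).symm) _
    refine ⟨n, by omega, 4 * (D + 1) ^ 2, hk,
      exists_mps_energyChain two_pos (by omega) (by omega) hD' hD hA hB
        (mps_cycle_ne_zero (by omega) (Dvd.intro _ rfl) hβ)
        ⟨cycleWord (fun i => if i = Fin.last D then 1 else 0) 0 (n - 4 * (D + 1) ^ 2), length_cycleWord _ _, ?_⟩⟩
    rw [listWord_transition, if_pos]
    · exact one_ne_zero
    · refine (run_cycleWord 0 _).trans ?_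
      rw [Option.some_inj, zero_add, ← vtx_zero, vtx_eq_iff, Nat.mod_eq_zero_of_dvd hdvd]
      simp
  -- The locality `6 D + 4` is at most `10 D`.
  · refine ⟨10, fun D D' hD' hD => ?_⟩
    obtain ⟨b, rfl⟩ := Nat.exists_eq_add_of_lt (show 0 < D' by omega)
    rw [zero_add] at hD' hD ⊢
    let α : Fin (b + 1) → Fin (2 * D) := fun i => ⟨i, by omega⟩
    let β : Fin (b + 1) → Fin (2 * D) := fun i => ⟨D + i, by omega⟩
    let α' : Fin (D + 1) → Fin (2 * D) := fun i => ⟨i, by omega⟩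
    -- The `D + 1` vertices would need `2 D + 2` letters. Two are saved: letter `D` is both the loop
    -- at `D` and the move from `0`, and letter `D + 1` is both the move from `1` and the move from
    -- `D`.
    let β' : Fin (D + 1) → Fin (2 * D) := fun i => ⟨if (i : ℕ) < D then D + i else D + 1, by
      split_ifs <;> omega⟩
    have hα : Function.Injective α := fun i i' h => Fin.ext (congrArg Fin.val h :)
    have hβ : Function.Injective β := fun i i' h => by
      have h1 : D + (i : ℕ) = D + i' := congrArg Fin.val h
      exact Fin.ext (by omega)
    have hαβ : ∀ i i', α i ≠ β i' := by
      intro i i' h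
      have h1 : (i : ℕ) = D + i' := congrArg Fin.val h
      omega
    have hα' : Function.Injective α' := fun i i' h => Fin.ext (congrArg Fin.val h :)
    have hβ'val : ∀ i i', α' i = β' i' → (i : ℕ) = if (i' : ℕ) < D then D + i' else D + 1 :=
      fun i i' h => congrArg Fin.val h
    have hαβ' : ∀ i, α' i ≠ β' i := by
      intro i h
      have h1 := hβ'val i i h
      split_ifs at h1 <;> omega
    have hne : ∀ i i', α' i = β' i' → i ≠ i' + 1 := by
      intro i i' h hii
      have h1 := hβ'val i i' h
      have h2 := congrArg Fin.val hii
      have h3 : (i' : ℕ) = 0 := by split_ifs at h1 <;> omega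
      rw [Fin.val_add, h3, Fin.val_one', zero_add, Nat.mod_mod, Nat.mod_eq_of_lt (by omega)] at h2
      split_ifs at h1 <;> omega
    have hu : ∀ i i' : Fin (D + 1), (i : ℕ) < D → α' i ≠ β' i' := by
      intro i i' hi h
      have h1 := hβ'val i i' h
      split_ifs at h1 <;> omega
    have hd : 0 < 2 * D := by omega
    have hA := isRigidFamily_loop (k := 6 * D + 4) (by omega) (by omega) hα hβ hαβ
    have hB := isDetectedFamily_loop (by omega) hαβ' hα' hne hu
    refine ⟨fun N => ⟨6 * D + 4 + N + 1, by omega, 6 * D + 4, by omega,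
      exists_mps_energyChain hd (by omega) (by omega) hD' hD hA hB
        (mps_loop_ne_zero (by omega) (by omega) hα fun i i' _ => hαβ i i')
        ⟨List.replicate _ (α' 0), List.length_replicate, ?_⟩⟩, 6 * D + 4, by omega,
      exists_imps_energyChain hd hD' hD hA hB⟩
    rw [listWord_transition, if_pos (run_loop_replicate α' β' _)]
    exact one_ne_zero
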